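/- **Setting.** Let $q\ge 0$, $d_{\max}\ge 0$, and let $\mathcal X$ be a measurable space. Let $\mathbb P$ be the law of $Z=(R,X,Y)\in\mathbb R^{d_{\max}}\times\mathcal X\times\mathbb R^q$; $R$ is an unobserved representation. Let $\mathcal G$ be a class of measurable rules $g:\mathbb R^{d_{\max}}\to\mathbb R^q$, and let $\ell(y,\hat y)=\|y-\hat y\|_2^2$. Let $\mathcal G_d$ be the set of $g\in\mathcal G$ that depend on the first $d$ coordinates only, $\mathcal L(g,\mathbb P)=\mathbb E_{\mathbb P}\,\ell(Y,g(R))$, and $\mathcal L_d=\min_{g\in\mathcal G_d}\mathcal L(g,\mathbb P)$, where the minimum is assumed to be attained, at $g_d$ $(0\le d\le d_{\max})$. The target order is $d^*=\min\{0\le d\le d_{\max}:\mathcal L_d=\mathcal L_{d_{\max}}\}$. Assume $\mathrm{var}\{\ell(Y,g_d(R))\}<\infty$ for $d\le d^*$ and $\sigma^2_{d^*}=\mathrm{var}\{\ell(Y,g_{d^*}(R))\}>0$. **Procedure.** Let $Z_i=(R_i,X_i,Y_i)$, $i\ge 1$, be i.i.d. from $\mathbb P$; only the $(X_i,Y_i)$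 are observed. Fix $K\ge 2$ and $\tau\in[0,1)$. For each $n$, $\{1,\dots,n\}$ is partitioned, at random and independently of the data, into folds $I_1,\dots,I_K$, and each $I_k$ into $I_{k,a},I_{k,b},I_{k,o}$, with non-random sizes such that $|I_{k,a}|=|I_{k,b}|$ and, as $n\to\infty$, $|I_k|/n\to 1/K$ and $|I_{k,o}|/(|I_{k,a}|+|I_{k,o}|)\to\tau$. Using only the observations outside $I_k$ (and possibly auxiliary randomness independent of the data), one fits, jointly measurably, a map $\hat\varphi_{-k}:\mathcal X\to\mathbb R^{d_{\max}}$ and rules $\hat g_{-k;d}\in\mathcal G_d$, $0\le d\le d_{\max}$. Let $\hat\ell_{d,k,i}=\ell(Y_i,\hat g_{-k;d}(\hat\varphi_{-k}(X_i)))$, and let $\mathrm{av}_S$ denote the average over $i\in S$ ($0$ if $S=\varnothing$). Put $$\hat\psi_d=\frac1K\sum_{k=1}^K\Big[\big\{\tau\,\mathrm{av}_{I_{k,o}}\hat\ell_{d,k,i}+(1-\tau)\,\mathrm{av}_{I_{k,a}}\hat\ell_{d,k,i}\big\}-\big\{\tau\,\mathrm{av}_{I_{k,o}}\hat\ell_{d_{\max},k,i}+(1-\tau)\,\mathrm{av}_{I_{k,b}}\hat\ell_{d_{\max},k,i}\big\}\Big],$$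 $$\hat\sigma^2_{d,k}=\mathrm{av}_{I_k}\big(\hat\ell_{d,k,i}-\mathrm{av}_{I_k}\hat\ell_{d,k,\cdot}\big)^2,\quad \hat\nu_d^2=\frac{1-\tau}{K}\sum_{k=1}^K(\hat\sigma^2_{d,k}+\hat\sigma^2_{d_{\max},k}),\quad \hat T_d=\Big(\frac n{2-\tau}\Big)^{1/2}\frac{\hat\psi_d}{\hat\nu_d}.$$ With $z_{1-\alpha}$ the $(1-\alpha)$-quantile of $\mathcal N(0,1)$, the sequential POD (predictive order determination) estimator $\hat d$ at level $\alpha$ is the least $d\in\{0,\dots,d_{\max}\}$ with $\hat T_d<z_{1-\alpha}$, and $d_{\max}$ if there is none. **Conditions.** Let $\|\cdot\|$ be a generic, possibly infinite, (semi)norm on measurable functions $z=(r,x,y)\mapsto h(z)\in\mathbb R^q$, for example the $L_2(\mathbb P)$- or the $L_\infty(\mathbb P)$-norm. In $g\circ\varphi-g_d$ the first term is evaluated at $x$ and the second at $r$. The conditions are required for every $k$, and conditional expectations are over a fresh $Z\sim\mathbb P$, with the fitted maps held fixed. - (C1) For $d^*\le d\le d_{\max}$ there is $C>0$ such that for all sequences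 of measurable $\varphi^{(j)}:\mathcal X\to\mathbb R^{d_{\max}}$ and $g^{(j)}\in\mathcal G_d$ with $\|g^{(j)}\circ\varphi^{(j)}-g_{d^*}\|\to0$, one has $|\mathbb E_{\mathbb P}\{\ell(Y,g^{(j)}\circ\varphi^{(j)}(X))-\ell(Y,g_{d^*}(R))\}|\le C\|g^{(j)}\circ\varphi^{(j)}-g_{d^*}\|^2$ for all large $j$. - (C2) For $d^*\le d\le d_{\max}$, $\|\hat g_{-k;d}\circ\hat\varphi_{-k}-g_{d^*}\|=o_P(n^{-1/4})$. - (C3) For $d^*\le d\le d_{\max}$, $\mathbb E_{\mathbb P}[\{\ell(Y,\hat g_{-k;d}\circ\hat\varphi_{-k}(X))-\ell(Y,g_{d^*}(R))\}^2\mid\hat g_{-k;d},\hat\varphi_{-k}]=o_P(1)$. - (C2') For $1\le d<d^*$, $\|\hat g_{-k;d}\circ\hat\varphi_{-k}-g_d\|_{L_2(\mathbb P)}=o_P(n^{-1/4})$. - (C3') For $1\le d<d^*$, $\mathbb E_{\mathbb P}[\{\ell(Y,\hat g_{-k;d}\circ\hat\varphi_{-k}(X))-\ell(Y,g_d(R))\}^2\mid\hat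 g_{-k;d},\hat\varphi_{-k}]=o_P(1)$. - If $d^*\ge1$, then $g_0\equiv\mathbb E(Y)$, and $\hat g_{-k;0}$ is the constant $|I_{-k}|^{-1}\sum_{i\in I_{-k}}Y_i$, where $I_{-k}=\{1,\dots,n\}\setminus I_k$. **Theorem (Consistency).** Under these conditions, let $\hat d$ be computed at level $\alpha_n\in(0,1)$ with $\alpha_n\to0$ and $(\log\alpha_n)/n\to0$. Then $\lim_{n\to\infty}\Pr(\hat d=d^*)=1$. -/

import Mathlib

open MeasureTheory ProbabilityTheory Filter Topology
open scoped ENNReal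

noncomputable section

namespace POD

/-- The space `ℝ^{d_max}` of (oracle or surrogate) representations. -/
abbrev Rep (D : ℕ) := EuclideanSpace ℝ (Fin D)

/-- The response space `ℝ^q`, which is also the prediction space. -/
abbrev Resp (q : ℕ) := EuclideanSpace ℝ (Fin q)

/-- An observation `(X, Y)`. -/
abbrev Obs (𝒳 : Type*) (q : ℕ) := 𝒳 × Resp q

/-- A complete draw `Z = (R, X, Y)`; the component `R` is not observed. -/
abbrev Full (D : ℕ) (𝒳 : Type*) (q : ℕ) := Rep D × 𝒳 × Resp q

/-- Squared loss. -/
def sqLoss {q : ℕ} (y y' : Resp q) : ℝ := ‖y - y'‖ ^ 2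

/-! ### Predictiveness and the target order -/

section Population

variable {D q : ℕ} {𝒳 : Type*} [MeasurableSpace 𝒳]

/-- The subclass `𝒢_d` of the rules in `𝒢` that depend on the first `d` coordinates only. -/
def subclass (𝒢 : Set (Rep D → Resp q)) (d : ℕ) : Set (Rep D → Resp q) :=
  {g | g ∈ 𝒢 ∧ ∀ r r' : Rep D, (∀ j : Fin D, (j : ℕ) < d → r j = r' j) → g r = g r'}

/-- The population risk `E_P ‖Y - g(R)‖²`, with values in `[0, ∞]`. -/
def risk (P : Measure (Full D 𝒳 q)) (g : Rep D → Resp q) : ℝ≥0∞ :=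
  ∫⁻ z, ENNReal.ofReal (sqLoss z.2.2 (g z.1)) ∂P

/-- The predictiveness `𝓛_d` at order `d`. -/
def predictiveness (P : Measure (Full D 𝒳 q)) (𝒢 : Set (Rep D → Resp q)) (d : ℕ) : ℝ≥0∞ :=
  ⨅ g ∈ subclass 𝒢 d, risk P g

/-- `g` attains the minimum that defines `𝓛_d`. -/
def IsRiskMinimizer (P : Measure (Full D 𝒳 q)) (𝒢 : Set (Rep D → Resp q)) (d : ℕ)
    (g : Rep D → Resp q) : Prop :=
  g ∈ subclass 𝒢 d ∧ risk P g = predictiveness P 𝒢 d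

/-- The target order `d* = min {0 ≤ d ≤ d_max : 𝓛_d = 𝓛_{d_max}}`. -/
def targetOrder (P : Measure (Full D 𝒳 q)) (𝒢 : Set (Rep D → Resp q)) : ℕ :=
  sInf {d | d ≤ D ∧ predictiveness P 𝒢 d = predictiveness P 𝒢 D}

/-- The random variable `ℓ(Y, g(R))`. -/
def oracleLoss (g : Rep D → Resp q) (z : Full D 𝒳 q) : ℝ := sqLoss z.2.2 (g z.1)

/-- The random variable `ℓ(Y, g(φ(X)))`. -/
def plugInLoss (φ : 𝒳 → Rep D) (g : Rep D → Resp q) (z : Full D 𝒳 q) : ℝ :=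
  sqLoss z.2.2 (g (φ z.2.1))

/-- The function `g ∘ φ - g₀` of `z = (r, x, y)`: here `g ∘ φ` is evaluated at `x`
and `g₀` at `r`. -/
def ruleGap (φ : 𝒳 → Rep D) (g g₀ : Rep D → Resp q) (z : Full D 𝒳 q) : Resp q :=
  g (φ z.2.1) - g₀ z.1

/-- A generic norm on measurable functions of `z`, possibly infinite or vanishing on nonzero
functions, such as an `L_p(P)` norm or the supremum over the support of `P`. -/
structure IsGenericNorm (N : (Full D 𝒳 q → Resp q) → ℝ≥0∞) : Prop where
  smul : ∀ (c : ℝ) (h : Full D 𝒳 q → Resp q), Measurable h → N (c • h) = ‖c‖ₑ * N h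
  add_le : ∀ h h' : Full D 𝒳 q → Resp q, Measurable h → Measurable h' →
    N (h + h') ≤ N h + N h'

/-- Risk curvature at order `d`, around the oracle rule `g₀`. -/
def RiskCurvature (P : Measure (Full D 𝒳 q)) (𝒢 : Set (Rep D → Resp q))
    (N : (Full D 𝒳 q → Resp q) → ℝ≥0∞) (g₀ : Rep D → Resp q) (d : ℕ) : Prop :=
  ∃ C : ℝ, 0 < C ∧ ∀ (φ : ℕ → 𝒳 → Rep D) (g : ℕ → Rep D → Resp q),
    (∀ j, Measurable (φ j)) → (∀ j, g j ∈ subclass 𝒢 d) →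
    Tendsto (fun j => N (ruleGap (φ j) (g j) g₀)) atTop (𝓝 0) →
    ∀ᶠ j in atTop,
      ENNReal.ofReal |∫ z, (plugInLoss (φ j) (g j) z - oracleLoss g₀ z) ∂P| ≤
        ENNReal.ofReal C * N (ruleGap (φ j) (g j) g₀) ^ 2

/-- The conditional expectation `E_P[{ℓ(Y, g∘φ(X)) - ℓ(Y, g₀(R))}² | g, φ]`: the fitted `φ` and
`g` are held fixed, and `Z ∼ P` is a fresh draw. -/
def sqLossGap (P : Measure (Full D 𝒳 q)) (φ : 𝒳 → Rep D) (g g₀ : Rep D → Resp q) : ℝ≥0∞ :=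
  ∫⁻ z, ENNReal.ofReal ((plugInLoss φ g z - oracleLoss g₀ z) ^ 2) ∂P

end Population

/-- `V_n = o_P(r_n)` for `[0, ∞]`-valued `V_n`. -/
def IsLittleOP {Ω : Type*} [MeasurableSpace Ω] (μ : Measure Ω) (V : ℕ → Ω → ℝ≥0∞)
    (r : ℕ → ℝ) : Prop :=
  ∀ ε : ℝ, 0 < ε → Tendsto (fun n => μ {ω | ENNReal.ofReal (ε * r n) < V n ω}) atTop (𝓝 0)

/-! ### The sequential procedure -/

/-- The user's choices: how `{1, …, n}` is split into folds, and which methods are fitted.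
The seed `u : 𝒰` carries all randomness that does not come from the data (the random split and,
possibly, randomized learners). `split n u i = (k, J)` says that `i` lies in the part `J` of the
fold `I_k`, where `J = 0, 1, 2` stand for `I_{k,a}`, `I_{k,b}`, `I_{k,o}`. The maps
`reduce n u k x` and `rule n u k d x` are `φ̂_{-k}` and `ĝ_{-k;d}`, fitted to the sample `x`. -/
structure Procedure (D q K : ℕ) (𝒳 𝒰 : Type*) [MeasurableSpace 𝒳] [MeasurableSpace 𝒰]
    (𝒢 : Set (Rep D → Resp q)) where
  split : (n : ℕ) → 𝒰 → Fin n → Fin K × Fin 3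
  reduce : (n : ℕ) → 𝒰 → Fin K → (Fin n → Obs 𝒳 q) → 𝒳 → Rep D
  rule : (n : ℕ) → 𝒰 → Fin K → ℕ → (Fin n → Obs 𝒳 q) → Rep D → Resp q
  /-- The common size of `I_{k,a}` and `I_{k,b}`. -/
  sizeA : ℕ → Fin K → ℕ
  /-- The size of `I_{k,o}`. -/
  sizeO : ℕ → Fin K → ℕ
  card_a : ∀ n u k, (Finset.univ.filter fun i => split n u i = (k, 0)).card = sizeA n k
  card_b : ∀ n u k, (Finset.univ.filter fun i => split n u i = (k, 1)).card = sizeA n k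
  card_o : ∀ n u k, (Finset.univ.filter fun i => split n u i = (k, 2)).card = sizeO n k
  /-- Only the observations outside `I_k` are used for fitting. -/
  reduce_train : ∀ n u k, DependsOn (reduce n u k) {i | (split n u i).1 ≠ k}
  rule_train : ∀ n u k d, DependsOn (rule n u k d) {i | (split n u i).1 ≠ k}
  rule_mem : ∀ n u k d x, d ≤ D → rule n u k d x ∈ subclass 𝒢 d
  measurable_split : ∀ n, Measurable (split n)
  measurable_reduce : ∀ n k,
    Measurable fun w : 𝒰 × (Fin n → Obs 𝒳 q) × 𝒳 => reduce n w.1 k w.2.1 w.2.2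
  measurable_rule : ∀ n k d, d ≤ D →
    Measurable fun w : 𝒰 × (Fin n → Obs 𝒳 q) × Rep D => rule n w.1 k d w.2.1 w.2.2

/-- The average of `f` over a finite index set. -/
def avg {ι : Type*} (S : Finset ι) (f : ι → ℝ) : ℝ := (∑ i ∈ S, f i) / (S.card : ℝ)

/-- The `p`-quantile of the standard normal distribution. -/
def normalQuantile (p : ℝ) : ℝ := sInf {t : ℝ | p ≤ cdf (gaussianReal 0 1) t}

namespace Procedure

variable {D q K : ℕ} {𝒳 𝒰 : Type*} [MeasurableSpace 𝒳] [MeasurableSpace 𝒰]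
  {𝒢 : Set (Rep D → Resp q)} (A : Procedure D q K 𝒳 𝒰 𝒢)
  (n : ℕ) (u : 𝒰) (x : Fin n → Obs 𝒳 q)

/-- The part `I_{k,J}`. -/
def part (k : Fin K) (J : Fin 3) : Finset (Fin n) :=
  Finset.univ.filter fun i => A.split n u i = (k, J)

/-- The fold `I_k`. -/
def fold (k : Fin K) : Finset (Fin n) := Finset.univ.filter fun i => (A.split n u i).1 = k

/-- The training indices `I_{-k}`. -/
def train (k : Fin K) : Finset (Fin n) := Finset.univ.filter fun i => (A.split n u i).1 ≠ k

/-- `ℓ(Y_i, ĝ_{-k;d}(R̂_i^{(k)}))`, where `R̂_i^{(k)} = φ̂_{-k}(X_i)`. -/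
def loss (k : Fin K) (d : ℕ) (i : Fin n) : ℝ :=
  sqLoss (x i).2 (A.rule n u k d x (A.reduce n u k x (x i).1))

/-- The contrast `ψ̂_d`. -/
def psiHat (τ : ℝ) (d : ℕ) : ℝ :=
  (1 / (K : ℝ)) * ∑ k : Fin K,
    ((τ * avg (A.part n u k 2) (A.loss n u x k d)
        + (1 - τ) * avg (A.part n u k 0) (A.loss n u x k d))
      - (τ * avg (A.part n u k 2) (A.loss n u x k D)
        + (1 - τ) * avg (A.part n u k 1) (A.loss n u x k D)))

/-- `σ̂²_{d,k}`. -/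
def sigmaSqHat (k : Fin K) (d : ℕ) : ℝ :=
  avg (A.fold n u k) fun i =>
    (A.loss n u x k d i - avg (A.fold n u k) (A.loss n u x k d)) ^ 2

/-- `ν̂²_d`. -/
def nuSqHat (τ : ℝ) (d : ℕ) : ℝ :=
  (1 - τ) * ((1 / (K : ℝ)) * ∑ k : Fin K, (A.sigmaSqHat n u x k d + A.sigmaSqHat n u x k D))

/-- The test statistic `T̂_d`. -/
def tStat (τ : ℝ) (d : ℕ) : ℝ :=
  √((n : ℝ) / (2 - τ)) * A.psiHat n u x τ d / √(A.nuSqHat n u x τ d)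

/-- The estimated order: the least `d ≤ d_max` with `T̂_d < z_{1-α}`, and `d_max` if there is
none. -/
def dHat (τ α : ℝ) : ℕ :=
  sInf (insert D {d | d ≤ D ∧ A.tStat n u x τ d < normalQuantile (1 - α)})

end Procedure

end POD

end

noncomputable section

namespace POD

/-! ### The filter of events of probability tending to one -/

/-! The critical value `z_n` tends to infinity, but more slowly than `√n`, and this alone separates
the two regimes; no central limit theorem is needed. The divergence comes from `α_n → 0`, the growth
bound from the Gaussian tail estimate `z_n ≤ √(-2 log α_n)`.

Below the target order the contrast converges to `𝓛_d - 𝓛_{d*} > 0`, so the statistic grows like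
`√n` and exceeds `z_n`. At the target order the losses fitted at `d*` and at `d_max` approach the
same oracle loss, so the contrast is centred at zero and only has to be `o_P(z_n / √n)`. Its error
has two sources: the noise of the held-out averages given the fit, `O_P(n^{-1/2})` by a conditional
Chebyshev inequality, and the bias of the mean fitted loss, also `O_P(n^{-1/2})` because curvature
squares the accuracy `n^{-1/4}` (`eventually_abs_fitMean_sub_le`). Both regimes are instances of
`tendsto_psiHat_rate`, with `r = 1` and `r = z_n / √n`. The denominators have positive limits, since
the loss variance at `d*` contributes to each of them. Orders above `d*` never matter for the least
accepted order.

Two devices carry the probability. Convergence in probability is convergence along the filter `whp`,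
so the usual calculus of limits applies. Conditioning on the training data is done by replacing the
held-out observations with an independent copy (`map_splice`, `pi_le_of_splice_le`), after which a
held-out average is an average of i.i.d. terms. -/

/-- The sets of pairs `(n, ω)` whose section at `n` has outer probability tending to one. Convergence
in probability of `X n` is convergence of `fun p => X p.1 p.2` along this filter. -/
def whp {Ω : Type*} [MeasurableSpace Ω] (μ : Measure Ω) : Filter (ℕ × Ω) where
  sets := {W | Tendsto (fun n => μ {ω | (n, ω) ∉ W}) atTop (𝓝 0)}
  univ_sets := by simp
  sets_of_superset := by
    intro W V hW hWV
    exact tendsto_of_tendsto_of_tendsto_of_le_of_le tendsto_const_nhds hW (fun _ => zero_le)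
      fun n => measure_mono fun ω h h' => h (hWV h')
  inter_sets := by
    intro W V hW hV
    have hWV := Tendsto.add (Set.mem_ofPred.1 hW) (Set.mem_ofPred.1 hV)
    rw [add_zero] at hWV
    refine tendsto_of_tendsto_of_tendsto_of_le_of_le tendsto_const_nhds hWV (fun _ => zero_le)
      fun n => (measure_mono ?_).trans (measure_union_le _ _)
    intro ω h
    by_cases h' : (n, ω) ∈ W
    · exact Or.inr fun h'' => h ⟨h', h''⟩
    · exact Or.inl h'

section Whp

variable {Ω : Type*} [MeasurableSpace Ω] {μ : Measure Ω}

lemma eventually_whp_iff {p : ℕ × Ω → Prop} :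
    (∀ᶠ z in whp μ, p z) ↔ Tendsto (fun n => μ {ω | ¬ p (n, ω)}) atTop (𝓝 0) :=
  Iff.rfl

lemma tendsto_fst_whp : Tendsto Prod.fst (whp μ) atTop := by
  intro s hs
  refine Filter.mem_map.2 (eventually_whp_iff.2 (tendsto_const_nhds.congr' ?_))
  filter_upwards [hs] with n hn
  simp [hn]

lemma eventually_whp_of_forall_le {p : ℕ × Ω → Prop}
    (h : ∀ δ : ℝ≥0∞, 0 < δ → ∀ᶠ n in atTop, μ {ω | ¬ p (n, ω)} ≤ δ) : ∀ᶠ z in whp μ, p z :=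
  eventually_whp_iff.2 (ENNReal.tendsto_nhds_zero.2 h)

/-- A bound that holds on an event of probability tending to one suffices. -/
lemma eventually_whp_of_and {p c : ℕ × Ω → Prop} (hc : ∀ᶠ z in whp μ, c z)
    {b : ℕ → ℝ≥0∞} (hb : Tendsto b atTop (𝓝 0))
    (h : ∀ᶠ n in atTop, μ {ω | c (n, ω) ∧ ¬ p (n, ω)} ≤ b n) : ∀ᶠ z in whp μ, p z := by
  have h' : ∀ᶠ z in whp μ, c z → p z := by
    refine eventually_whp_iff.2 (tendsto_of_tendsto_of_tendsto_of_le_of_le' tendsto_const_nhds hb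
      (Eventually.of_forall fun _ => zero_le) ?_)
    filter_upwards [h] with n hn
    simpa only [Classical.not_imp] using hn
  filter_upwards [hc, h'] with z hz hz' using hz' hz

lemma tendsto_whp_zero {X : ℕ × Ω → ℝ} (h : ∀ ε > 0, ∀ᶠ z in whp μ, |X z| < ε) :
    Tendsto X (whp μ) (𝓝 0) := by
  rw [Metric.tendsto_nhds]
  simpa [Real.dist_eq] using h

lemma IsLittleOP.eventually {V : ℕ → Ω → ℝ≥0∞} {r : ℕ → ℝ} (h : IsLittleOP μ V r) {ε : ℝ}
    (hε : 0 < ε) : ∀ᶠ z in whp μ, V z.1 z.2 ≤ ENNReal.ofReal (ε * r z.1) := by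
  refine eventually_whp_iff.2 ?_
  simpa only [not_le] using h ε hε

lemma IsLittleOP.tendsto {V : ℕ → Ω → ℝ≥0∞} (h : IsLittleOP μ V fun _ => 1) :
    Tendsto (fun z : ℕ × Ω => V z.1 z.2) (whp μ) (𝓝 0) := by
  rw [ENNReal.tendsto_nhds_zero]
  intro ε hε
  by_cases hε' : ε = ∞
  · simp [hε']
  · filter_upwards [h.eventually (ENNReal.toReal_pos hε.ne' hε')] with z hz
    simpa [ENNReal.ofReal_toReal hε'] using hz

/-- Subadditivity gives `1 - μ(pᶜ) ≤ μ(p)` even for outer measure, so the event need not be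
measurable. -/
lemma tendsto_measure_one_of_whp [IsProbabilityMeasure μ] {p : ℕ × Ω → Prop}
    (h : ∀ᶠ z in whp μ, p z) : Tendsto (fun n => μ {ω | p (n, ω)}) atTop (𝓝 1) := by
  have h' : Tendsto (fun n => 1 - μ {ω | ¬ p (n, ω)}) atTop (𝓝 (1 - 0)) :=
    ENNReal.Tendsto.sub tendsto_const_nhds (eventually_whp_iff.1 h) (by simp)
  rw [tsub_zero] at h'
  refine tendsto_of_tendsto_of_tendsto_of_le_of_le h' tendsto_const_nhds (fun n => ?_)
    fun n => prob_le_one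
  rw [tsub_le_iff_right, ← measure_univ (μ := μ)]
  refine (measure_mono fun ω _ => ?_).trans (measure_union_le _ _)
  exact em _

end Whp

/-! ### Quantiles of the standard normal distribution -/

/-- Lebesgue measure is absolutely continuous with respect to the Gaussian, so no half-line is null.
The strictness is what drives the quantiles to infinity. -/
lemma cdf_gaussian_lt_one (t : ℝ) : cdf (gaussianReal 0 1) t < 1 := by
  have h : 0 < gaussianReal 0 1 (Set.Ioi t) := by
    refine pos_iff_ne_zero.2 fun h0 => ?_
    have := gaussianReal_absolutelyContinuous' 0 (one_ne_zero) h0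
    simp at this
  rw [cdf_eq_real, ← not_le]
  intro h1
  have h2 : (gaussianReal 0 1).real (Set.Iic t)ᶜ = 1 - (gaussianReal 0 1).real (Set.Iic t) :=
    probReal_compl_eq_one_sub measurableSet_Iic
  rw [Set.compl_Iic] at h2
  have h3 : 0 < (gaussianReal 0 1).real (Set.Ioi t) := ENNReal.toReal_pos h.ne' (by simp)
  linarith

/-- The Chernoff bound, with the optimal exponent equal to the threshold `t` itself. -/
lemma one_sub_exp_le_cdf_gaussian {t : ℝ} (ht : 0 ≤ t) :
    1 - Real.exp (-t ^ 2 / 2) ≤ cdf (gaussianReal 0 1) t := by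
  have h := measure_ge_le_exp_mul_mgf (X := id) (μ := gaussianReal 0 1) t ht
    (by simpa using integrable_exp_mul_gaussianReal (μ := 0) (v := 1) t)
  rw [mgf_gaussianReal (by simp : Measure.map id (gaussianReal 0 1) = gaussianReal 0 1),
    ← Real.exp_add] at h
  have h2 : (gaussianReal 0 1).real (Set.Iic t)ᶜ = 1 - (gaussianReal 0 1).real (Set.Iic t) :=
    probReal_compl_eq_one_sub measurableSet_Iic
  have h3 : (gaussianReal 0 1).real (Set.Iic t)ᶜ ≤ (gaussianReal 0 1).real {ω | t ≤ id ω} :=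
    measureReal_mono (by intro x hx; simp at hx ⊢; exact hx.le)
  rw [cdf_eq_real]
  have h4 : -t * t + (0 * t + ((1 : NNReal) : ℝ) * t ^ 2 / 2) = -t ^ 2 / 2 := by
    simp; ring
  rw [h4] at h
  linarith

lemma lt_of_cdf_gaussian_lt {s t p : ℝ} (hs : cdf (gaussianReal 0 1) s < p)
    (ht : p ≤ cdf (gaussianReal 0 1) t) : s < t :=
  (monotone_cdf _).reflect_lt (hs.trans_le ht)

/-- `p < 1` makes the set in the quantile nonempty, which excludes the default value of the infimum;
the companion bound uses `0 < p` to have the set bounded below. -/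
lemma le_normalQuantile {s p : ℝ} (hs : cdf (gaussianReal 0 1) s < p) (hp : p < 1) :
    s ≤ normalQuantile p := by
  obtain ⟨t, ht⟩ := ((tendsto_cdf_atTop (gaussianReal 0 1)).eventually
    (eventually_gt_nhds hp)).exists
  exact le_csInf ⟨t, ht.le⟩ fun t ht => (lt_of_cdf_gaussian_lt hs ht).le

lemma normalQuantile_le {t p : ℝ} (hp : 0 < p) (ht : p ≤ cdf (gaussianReal 0 1) t) :
    normalQuantile p ≤ t := by
  obtain ⟨s, hs⟩ := ((tendsto_cdf_atBot (gaussianReal 0 1)).eventually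
    (eventually_lt_nhds hp)).exists
  exact csInf_le ⟨s, fun t ht => (lt_of_cdf_gaussian_lt hs ht).le⟩ ht

lemma normalQuantile_one_sub_le {a : ℝ} (ha : 0 < a) (ha1 : a < 1) :
    normalQuantile (1 - a) ≤ √(-2 * Real.log a) := by
  refine normalQuantile_le (by linarith) (le_trans ?_ (one_sub_exp_le_cdf_gaussian (by positivity)))
  have hlog := Real.log_neg ha ha1
  rw [Real.sq_sqrt (by linarith), show -(-2 * Real.log a) / 2 = Real.log a by ring,
    Real.exp_log ha]

lemma tendsto_normalQuantile {α : ℕ → ℝ} (hα : ∀ n, 0 < α n) (hα0 : Tendsto α atTop (𝓝 0)) :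
    Tendsto (fun n => normalQuantile (1 - α n)) atTop atTop := by
  rw [tendsto_atTop]
  intro t
  have h := cdf_gaussian_lt_one t
  filter_upwards [hα0.eventually (eventually_lt_nhds (sub_pos.2 h))] with n hn
  exact le_normalQuantile (by linarith) (by linarith [hα n])

lemma tendsto_normalQuantile_div_sqrt {α : ℕ → ℝ} (hα : ∀ n, 0 < α n ∧ α n < 1)
    (hα0 : Tendsto α atTop (𝓝 0))
    (hαlog : Tendsto (fun n : ℕ => Real.log (α n) / n) atTop (𝓝 0)) :
    Tendsto (fun n : ℕ => normalQuantile (1 - α n) / √(n : ℝ)) atTop (𝓝 0) := by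
  have h1 : Tendsto (fun n : ℕ => √(-2 * (Real.log (α n) / n))) atTop (𝓝 0) := by
    simpa using (hαlog.const_mul (-2)).sqrt
  refine tendsto_of_tendsto_of_tendsto_of_le_of_le' tendsto_const_nhds h1 ?_ ?_
  · filter_upwards [(tendsto_normalQuantile (fun n => (hα n).1) hα0).eventually_ge_atTop 0] with n hn
    positivity
  · refine Eventually.of_forall fun n => ?_
    rw [mul_div_assoc', Real.sqrt_div (by nlinarith [Real.log_neg (hα n).1 (hα n).2])]
    gcongr
    exact normalQuantile_one_sub_le (hα n).1 (hα n).2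

/-! ### Averages over a random subset of an i.i.d. sample -/

section Resample

variable {n : ℕ} {𝒵 : Type*}

open Classical in
/-- The sample that agrees with `x` on `T` and with `y` elsewhere. -/
def splice (T : Set (Fin n)) (x y : Fin n → 𝒵) : Fin n → 𝒵 := fun i => if i ∈ T then x i else y i

lemma splice_of_mem {T : Set (Fin n)} {x y : Fin n → 𝒵} {i : Fin n} (hi : i ∈ T) :
    splice T x y i = x i := if_pos hi

lemma splice_of_notMem {T : Set (Fin n)} {x y : Fin n → 𝒵} {i : Fin n} (hi : i ∉ T) :
    splice T x y i = y i := if_neg hi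

lemma splice_of_mem_finset {n : ℕ} {s : Finset (Fin n)} {x y : Fin n → 𝒵} {i : Fin n}
    (hi : i ∈ s) : splice {i | i ∉ s} x y i = y i :=
  splice_of_notMem (by simpa using hi)

variable [MeasurableSpace 𝒵]

lemma measurable_splice (T : Set (Fin n)) :
    Measurable fun w : (Fin n → 𝒵) × (Fin n → 𝒵) => splice T w.1 w.2 := by
  refine measurable_pi_lambda _ fun i => ?_
  by_cases hi : i ∈ T
  · simp only [splice_of_mem hi]
    fun_prop
  · simp only [splice_of_notMem hi]
    fun_prop

/-- Replacing part of an i.i.d. sample by an independent copy does not change its law. -/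
lemma map_splice (P : Measure 𝒵) [IsProbabilityMeasure P] (T : Set (Fin n)) :
    ((Measure.pi fun _ : Fin n => P).prod (Measure.pi fun _ : Fin n => P)).map
      (fun w => splice T w.1 w.2) = Measure.pi fun _ => P := by
  classical
  symm
  refine Measure.pi_eq fun s hs => ?_
  rw [Measure.map_apply (measurable_splice T) (MeasurableSet.univ_pi hs)]
  have : (fun w : (Fin n → 𝒵) × (Fin n → 𝒵) => splice T w.1 w.2) ⁻¹' Set.univ.pi s =
      (Set.univ.pi fun i => if i ∈ T then s i else Set.univ) ×ˢ
        (Set.univ.pi fun i => if i ∈ T then Set.univ else s i) := by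
    ext w
    simp only [Set.mem_preimage, Set.mem_pi, Set.mem_univ, true_implies, Set.mem_prod, splice]
    rw [← forall_and]
    refine forall_congr' fun i => ?_
    by_cases hi : i ∈ T <;> simp [hi]
  rw [this, Measure.prod_prod, Measure.pi_pi, Measure.pi_pi, ← Finset.prod_mul_distrib]
  refine Finset.prod_congr rfl fun i _ => ?_
  by_cases hi : i ∈ T <;> simp [hi]

/-- Fubini applied to `map_splice`: a bound that is uniform in the frozen coordinates integrates to
itself. It takes the place of regular conditional probabilities. -/
lemma pi_le_of_splice_le (P : Measure 𝒵) [IsProbabilityMeasure P] (T : Set (Fin n))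
    {E : Set (Fin n → 𝒵)} (hE : MeasurableSet E) {b : ℝ≥0∞}
    (h : ∀ x, Measure.pi (fun _ : Fin n => P) {y | splice T x y ∈ E} ≤ b) :
    Measure.pi (fun _ : Fin n => P) E ≤ b := by
  rw [← map_splice P T, Measure.map_apply (measurable_splice T) hE,
    Measure.prod_apply (measurable_splice T hE)]
  calc _ ≤ ∫⁻ _, b ∂(Measure.pi fun _ : Fin n => P) := lintegral_mono fun x => h x
    _ = b := by simp

lemma pi_chebyshev_avg (P : Measure 𝒵) [IsProbabilityMeasure P] {f : 𝒵 → ℝ} (hf : Measurable f)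
    {B : ℝ} (hB : ∫⁻ z, ENNReal.ofReal (f z ^ 2) ∂P ≤ ENNReal.ofReal B) (hB0 : 0 ≤ B)
    (S : Finset (Fin n)) (hS : 0 < S.card) {t : ℝ} (ht : 0 < t) :
    Measure.pi (fun _ : Fin n => P) {y | t ≤ |avg S (fun i => f (y i)) - ∫ z, f z ∂P|} ≤
      ENNReal.ofReal (B / (S.card * t ^ 2)) := by
  classical
  have hint : Integrable (fun z => f z ^ 2) P := by
    refine ⟨by fun_prop, ?_⟩
    rw [hasFiniteIntegral_iff_ofReal (Eventually.of_forall fun z => sq_nonneg _)]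
    exact hB.trans_lt ENNReal.ofReal_lt_top
  have hL2 : MemLp f 2 P := (memLp_two_iff_integrable_sq hf.aestronglyMeasurable).2 hint
  have hvar : Var[f; P] ≤ B := by
    refine (variance_le_expectation_sq hf.aestronglyMeasurable).trans ?_
    rw [← ofReal_integral_eq_lintegral_ofReal hint (Eventually.of_forall fun z => sq_nonneg _)] at hB
    exact (ENNReal.ofReal_le_ofReal_iff hB0).1 hB
  have hm : (0 : ℝ) < S.card := by exact_mod_cast hS
  -- Extending by zero off `S` turns the partial sum into a sum over all coordinates, for which the
  -- variance of independent summands is additive.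
  let X : Fin n → 𝒵 → ℝ := fun i => if i ∈ S then f else 0
  have hX : ∀ i, MemLp (X i) 2 P := fun i => by
    by_cases hi : i ∈ S <;> simp [X, hi, hL2]
  have hmp := fun i => measurePreserving_eval (fun _ : Fin n => P) i
  have hXL : ∀ i, MemLp (fun y : Fin n → 𝒵 => X i (y i)) 2 (Measure.pi fun _ => P) := fun i =>
    (hX i).comp_measurePreserving (hmp i)
  have hsum : ∀ y : Fin n → 𝒵, (∑ i, fun y : Fin n → 𝒵 => X i (y i)) y = ∑ i ∈ S, f (y i) := by
    intro y
    rw [Finset.sum_apply, ← Finset.sum_filter_add_sum_filter_not Finset.univ (· ∈ S)]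
    rw [Finset.sum_eq_zero (s := Finset.univ.filter fun i => i ∉ S), add_zero]
    · simp only [Finset.filter_mem_eq_inter, Finset.univ_inter]
      exact Finset.sum_congr rfl fun i hi => by simp [X, hi]
    · intro i hi
      simp only [Finset.mem_filter] at hi
      simp [X, hi.2]
  have hE : ∫ y, (∑ i, fun y : Fin n → 𝒵 => X i (y i)) y ∂(Measure.pi fun _ => P) =
      S.card * ∫ z, f z ∂P := by
    simp only [hsum]
    have hi : ∀ i, Integrable (fun y : Fin n → 𝒵 => f (y i)) (Measure.pi fun _ => P) := fun i =>
      (hmp i).integrable_comp_of_integrable (hL2.integrable one_le_two)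
    rw [integral_finsetSum S fun i _ => hi i]
    rw [Finset.sum_congr rfl fun i _ => integral_comp_eval hf.aestronglyMeasurable]
    simp
  have hV : Var[∑ i, fun y : Fin n → 𝒵 => X i (y i); Measure.pi fun _ => P] ≤ S.card * B := by
    rw [variance_sum_pi hX]
    calc ∑ i, Var[X i; P] ≤ ∑ i, if i ∈ S then B else 0 := by
          refine Finset.sum_le_sum fun i _ => ?_
          by_cases hi : i ∈ S <;> simp [X, hi, hvar]
      _ = S.card * B := by simp
  have hch := meas_ge_le_variance_div_sq (memLp_finsetSum' Finset.univ fun i _ => hXL i)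
    (mul_pos hm ht)
  rw [hE] at hch
  calc _ ≤ _ := measure_mono ?_
    _ ≤ _ := hch
    _ ≤ _ := ENNReal.ofReal_le_ofReal ?_
  · intro y hy
    simp only [Set.mem_ofPred_eq, avg] at hy ⊢
    rw [hsum]
    have : ∑ i ∈ S, f (y i) - S.card * ∫ z, f z ∂P =
        S.card * ((∑ i ∈ S, f (y i)) / S.card - ∫ z, f z ∂P) := by field_simp
    rw [this, abs_mul, abs_of_pos hm]
    gcongr
  · calc _ ≤ (S.card * B) / (S.card * t) ^ 2 := by gcongr
      _ = _ := by field_simp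

lemma pi_markov_avg (P : Measure 𝒵) [IsProbabilityMeasure P] {f : 𝒵 → ℝ} (hf : Measurable f)
    {B : ℝ≥0∞} (hB : ∫⁻ z, ENNReal.ofReal |f z| ∂P ≤ B)
    (S : Finset (Fin n)) {t : ℝ} (ht : 0 < t) :
    Measure.pi (fun _ : Fin n => P) {y | t ≤ avg S (fun i => |f (y i)|)} ≤
      B / ENNReal.ofReal t := by
  have hmp := fun i => measurePreserving_eval (fun _ : Fin n => P) i
  have hmeas : Measurable fun y : Fin n → 𝒵 => ENNReal.ofReal (avg S fun i => |f (y i)|) := by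
    unfold avg
    fun_prop
  have h := mul_meas_ge_le_lintegral₀ (μ := Measure.pi fun _ : Fin n => P)
    hmeas.aemeasurable (ENNReal.ofReal t)
  rw [ENNReal.le_div_iff_mul_le (Or.inl (by simpa using ht)) (Or.inl (by simp)), mul_comm]
  refine le_trans ?_ (h.trans ?_)
  · gcongr
    exact ENNReal.ofReal_le_ofReal
  -- The average over the empty set is zero, so no lower bound on the size is required.
  · rcases S.eq_empty_or_nonempty with rfl | hS
    · simp [avg]
    have hm : (0 : ℝ) < S.card := by exact_mod_cast hS.card_pos
    have : ∀ y : Fin n → 𝒵, ENNReal.ofReal (avg S fun i => |f (y i)|) =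
        ENNReal.ofReal (S.card : ℝ)⁻¹ * ∑ i ∈ S, ENNReal.ofReal |f (y i)| := by
      intro y
      rw [← ENNReal.ofReal_sum_of_nonneg fun i _ => abs_nonneg _,
        ← ENNReal.ofReal_mul (by positivity), avg, div_eq_inv_mul]
    simp only [this]
    rw [lintegral_const_mul _ (by fun_prop), lintegral_finsetSum _ (by fun_prop)]
    rw [Finset.sum_congr rfl fun i _ => (hmp i).lintegral_comp (f := fun z => ENNReal.ofReal |f z|)
      (by fun_prop)]
    rw [Finset.sum_const, nsmul_eq_mul, ← mul_assoc, ENNReal.ofReal_inv_of_pos hm,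
      ENNReal.ofReal_natCast, ENNReal.inv_mul_cancel (by simpa using hS.card_pos.ne') (by simp),
      one_mul]
    exact hB

end Resample

section Sampling

variable {Ω 𝒰 𝒵 : Type*} [MeasurableSpace Ω] [MeasurableSpace 𝒰] [MeasurableSpace 𝒵]

/-- Draws `Z 0, Z 1, …` that are i.i.d. from `P`, together with an independent seed `U`. -/
structure IsSeededSample (μ : Measure Ω) (P : Measure 𝒵) (Z : ℕ → Ω → 𝒵) (U : Ω → 𝒰) : Prop where
  measurable_draw : ∀ i, Measurable (Z i)
  measurable_seed : Measurable U
  map_eq : ∀ n, μ.map (fun ω => (U ω, fun i : Fin n => Z i ω)) =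
    (μ.map U).prod (Measure.pi fun _ => P)

lemma isSeededSample_of_iIndepFun {μ : Measure Ω} [IsProbabilityMeasure μ] {P : Measure 𝒵}
    {Z : ℕ → Ω → 𝒵} {U : Ω → 𝒰} (hZ : ∀ i, Measurable (Z i))
    (hlaw : ∀ i, μ.map (Z i) = P) (hindep : iIndepFun Z μ)
    (hU : Measurable U) (hseed : IndepFun U (fun ω i => Z i ω) μ) :
    IsSeededSample μ P Z U := by
  refine ⟨hZ, hU, fun n => ?_⟩
  have h1 : IndepFun U (fun ω (i : Fin n) => Z i ω) μ :=
    hseed.comp measurable_id (ψ := fun (z : ℕ → 𝒵) (i : Fin n) => z i) (by fun_prop)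
  rw [(indepFun_iff_map_prod_eq_prod_map_map hU.aemeasurable
    (measurable_pi_lambda (fun ω (i : Fin n) => Z i ω) fun i => hZ i).aemeasurable).1 h1]
  have h2 : iIndepFun (fun (i : Fin n) => Z i) μ := hindep.precomp Fin.val_injective
  rw [(iIndepFun_iff_map_fun_eq_pi_map fun i : Fin n => (hZ i).aemeasurable).1 h2]
  simp only [hlaw]

/-- Random index sets, chosen by the seed, with non-random sizes `m n`. -/
structure IsSeededSubset (S : (n : ℕ) → 𝒰 → Finset (Fin n)) (m : ℕ → ℕ) : Prop where
  card_eq : ∀ n u, (S n u).card = m n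
  measurable : ∀ n i, MeasurableSet {u | i ∈ S n u}

/-- Functions `H n u x` of a draw that are fitted to the sample `x` without the use of the
observations in `S n u`. -/
structure IsFittedOutside (H : (n : ℕ) → 𝒰 → (Fin n → 𝒵) → 𝒵 → ℝ)
    (S : (n : ℕ) → 𝒰 → Finset (Fin n)) : Prop where
  measurable : ∀ n, Measurable fun w : 𝒰 × (Fin n → 𝒵) × 𝒵 => H n w.1 w.2.1 w.2.2
  dependsOn : ∀ n u, DependsOn (H n u) {i | i ∉ S n u}

lemma isFittedOutside_const {f : 𝒵 → ℝ} (hf : Measurable f)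
    (S : (n : ℕ) → 𝒰 → Finset (Fin n)) : IsFittedOutside (fun _ _ _ => f) S :=
  ⟨fun _ => by fun_prop, fun _ _ _ _ _ => rfl⟩

variable {S : (n : ℕ) → 𝒰 → Finset (Fin n)} {m : ℕ → ℕ}
  {H : (n : ℕ) → 𝒰 → (Fin n → 𝒵) → 𝒵 → ℝ}

lemma IsFittedOutside.comp (hH : IsFittedOutside H S) {φ : 𝒵 → ℝ → ℝ}
    (hφ : Measurable fun w : 𝒵 × ℝ => φ w.1 w.2) :
    IsFittedOutside (fun n u x z => φ z (H n u x z)) S := by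
  refine ⟨fun n => ?_, fun n u x y hxy => ?_⟩
  · exact hφ.comp ((measurable_snd.comp measurable_snd).prodMk (hH.measurable n))
  · simp only [hH.dependsOn n u hxy]

/-- Because the size is not random, the average over a random set is a finite sum with indicator
weights divided by a constant. -/
lemma IsSeededSubset.measurable_avg (hS : IsSeededSubset S m) {n : ℕ}
    {F : 𝒰 × (Fin n → 𝒵) → Fin n → ℝ} (hF : ∀ i, Measurable fun w => F w i) :
    Measurable fun w : 𝒰 × (Fin n → 𝒵) => avg (S n w.1) (F w) := by
  classical
  have : (fun w : 𝒰 × (Fin n → 𝒵) => avg (S n w.1) (F w)) =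
      fun w => (∑ i, if i ∈ S n w.1 then F w i else 0) / (m n : ℝ) := by
    funext w
    rw [avg, hS.card_eq]
    simp
  rw [this]
  refine (Finset.measurable_fun_sum _ fun i _ => ?_).div_const _
  exact Measurable.ite (measurable_fst (hS.measurable n i)) (hF i) measurable_const

lemma IsFittedOutside.measurable_eval (hH : IsFittedOutside H S) {n : ℕ} (i : Fin n) :
    Measurable fun w : 𝒰 × (Fin n → 𝒵) => H n w.1 w.2 (w.2 i) :=
  (hH.measurable n).comp (f := fun w : 𝒰 × (Fin n → 𝒵) => (w.1, w.2, w.2 i)) (by fun_prop)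

lemma IsFittedOutside.measurable_section (hH : IsFittedOutside H S) (n : ℕ) (u : 𝒰)
    (x : Fin n → 𝒵) : Measurable (H n u x) :=
  (hH.measurable n).comp (f := fun z : 𝒵 => (u, x, z)) (by fun_prop)

section Prob

variable {μ : Measure Ω} [IsProbabilityMeasure μ] {P : Measure 𝒵} [IsProbabilityMeasure P]
  {Z : ℕ → Ω → 𝒵} {U : Ω → 𝒰}

/-- Conditioning on the seed and on the observations outside `S`. -/
lemma IsSeededSample.measure_le (hZU : IsSeededSample μ P Z U) (S : (n : ℕ) → 𝒰 → Finset (Fin n))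
    {n : ℕ} {E : Set (𝒰 × (Fin n → 𝒵))} (hE : MeasurableSet E) {b : ℝ≥0∞}
    (h : ∀ u x, Measure.pi (fun _ : Fin n => P)
      {y | (u, splice {i | i ∉ S n u} x y) ∈ E} ≤ b) :
    μ {ω | (U ω, fun i : Fin n => Z i ω) ∈ E} ≤ b := by
  have hm : Measurable fun ω => (U ω, fun i : Fin n => Z i ω) :=
    hZU.measurable_seed.prodMk (measurable_pi_lambda _ fun i => hZU.measurable_draw i)
  have : IsProbabilityMeasure (μ.map U) := Measure.isProbabilityMeasure_map
    hZU.measurable_seed.aemeasurable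
  calc μ {ω | (U ω, fun i : Fin n => Z i ω) ∈ E}
      = μ.map (fun ω => (U ω, fun i : Fin n => Z i ω)) E := (Measure.map_apply hm hE).symm
    _ = ∫⁻ u, Measure.pi (fun _ : Fin n => P) (Prod.mk u ⁻¹' E) ∂(μ.map U) := by
      rw [hZU.map_eq, Measure.prod_apply hE]
    _ ≤ ∫⁻ _, b ∂(μ.map U) := lintegral_mono fun u =>
      pi_le_of_splice_le P {i | i ∉ S n u} (measurable_prodMk_left hE) (h u)
    _ = b := by simp

lemma IsFittedOutside.splice_eq (hH : IsFittedOutside H S) {n : ℕ} (u : 𝒰) (x y : Fin n → 𝒵) :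
    H n u (splice {i | i ∉ S n u} x y) = H n u x :=
  hH.dependsOn n u fun _ hi => splice_of_mem hi

/-- The conditional Chebyshev inequality. -/
lemma IsSeededSample.chebyshev (hZU : IsSeededSample μ P Z U) (hS : IsSeededSubset S m)
    (hH : IsFittedOutside H S) {n : ℕ} (hm : 0 < m n) {B t : ℝ} (hB : 0 ≤ B) (ht : 0 < t) :
    μ {ω | ∫⁻ z, ENNReal.ofReal (H n (U ω) (fun i => Z i ω) z ^ 2) ∂P ≤ ENNReal.ofReal B ∧
      t ≤ |avg (S n (U ω)) (fun i => H n (U ω) (fun i => Z i ω) (Z i ω)) -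
        ∫ z, H n (U ω) (fun i => Z i ω) z ∂P|} ≤ ENNReal.ofReal (B / (m n * t ^ 2)) := by
  have hmeas : Measurable fun w : (𝒰 × (Fin n → 𝒵)) × 𝒵 => H n w.1.1 w.1.2 w.2 :=
    (hH.measurable n).comp
      (f := fun w : (𝒰 × (Fin n → 𝒵)) × 𝒵 => (w.1.1, w.1.2, w.2)) (by fun_prop)
  refine hZU.measure_le S (E := {w | ∫⁻ z, ENNReal.ofReal (H n w.1 w.2 z ^ 2) ∂P ≤
    ENNReal.ofReal B ∧ t ≤ |avg (S n w.1) (fun i => H n w.1 w.2 (w.2 i)) -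
      ∫ z, H n w.1 w.2 z ∂P|}) ?_ fun u x => ?_
  · have h1 := Measurable.lintegral_prod_right' (ν := P) (hmeas.pow_const 2).ennreal_ofReal
    have h2 := hS.measurable_avg (n := n) fun i => hH.measurable_eval i
    have h3 := (StronglyMeasurable.integral_prod_right' (ν := P)
      hmeas.stronglyMeasurable).measurable
    exact (measurableSet_le h1 measurable_const).inter
      (measurableSet_le measurable_const (h2.sub h3).abs)
  · simp only [Set.mem_ofPred_eq, hH.splice_eq]
    by_cases hx : ∫⁻ z, ENNReal.ofReal (H n u x z ^ 2) ∂P ≤ ENNReal.ofReal B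
    · simp only [hx, true_and]
      rw [← hS.card_eq n u] at hm ⊢
      refine le_trans (measure_mono fun y hy => ?_)
        (pi_chebyshev_avg P (hH.measurable_section n u x) hx hB (S n u) hm ht)
      simpa only [Set.mem_ofPred_eq, avg,
        Finset.sum_congr rfl fun i hi => congrArg (H n u x) (splice_of_mem_finset hi)] using hy
    · simp [hx]

/-- The conditional Markov inequality. -/
lemma IsSeededSample.markov (hZU : IsSeededSample μ P Z U) (hS : IsSeededSubset S m)
    (hH : IsFittedOutside H S) {n : ℕ} {B : ℝ≥0∞} {t : ℝ} (ht : 0 < t) :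
    μ {ω | ∫⁻ z, ENNReal.ofReal |H n (U ω) (fun i => Z i ω) z| ∂P ≤ B ∧
      t ≤ avg (S n (U ω)) (fun i => |H n (U ω) (fun i => Z i ω) (Z i ω)|)} ≤
      B / ENNReal.ofReal t := by
  have hmeas : Measurable fun w : (𝒰 × (Fin n → 𝒵)) × 𝒵 => H n w.1.1 w.1.2 w.2 :=
    (hH.measurable n).comp
      (f := fun w : (𝒰 × (Fin n → 𝒵)) × 𝒵 => (w.1.1, w.1.2, w.2)) (by fun_prop)
  refine hZU.measure_le S (E := {w | ∫⁻ z, ENNReal.ofReal |H n w.1 w.2 z| ∂P ≤ B ∧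
    t ≤ avg (S n w.1) (fun i => |H n w.1 w.2 (w.2 i)|)}) ?_ fun u x => ?_
  · have h1 := Measurable.lintegral_prod_right' (ν := P) hmeas.abs.ennreal_ofReal
    have h2 := hS.measurable_avg (n := n) fun i => (hH.measurable_eval i).abs
    exact (measurableSet_le h1 measurable_const).inter (measurableSet_le measurable_const h2)
  · simp only [Set.mem_ofPred_eq, hH.splice_eq]
    by_cases hx : ∫⁻ z, ENNReal.ofReal |H n u x z| ∂P ≤ B
    · simp only [hx, true_and]
      refine le_trans (measure_mono fun y hy => ?_)
        (pi_markov_avg P (hH.measurable_section n u x) hx (S n u) ht)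
      simpa only [Set.mem_ofPred_eq, avg, Finset.sum_congr rfl fun i hi =>
        congrArg (fun z => |H n u x z|) (splice_of_mem_finset hi)] using hy
    · simp [hx]

/-- The law of large numbers for fitted functions with bounded second moments, at rate `r`. -/
lemma IsSeededSample.tendsto_avg_sub_div (hZU : IsSeededSample μ P Z U)
    (hS : IsSeededSubset S m) (hH : IsFittedOutside H S) {B : ℝ} (hB : 0 ≤ B)
    (hHB : ∀ᶠ p in whp μ, ∫⁻ z, ENNReal.ofReal (H p.1 (U p.2) (fun i => Z i p.2) z ^ 2) ∂P ≤
      ENNReal.ofReal B)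
    {r : ℕ → ℝ} (hr : Tendsto (fun n => (m n : ℝ) * r n ^ 2) atTop atTop) :
    Tendsto (fun p : ℕ × Ω => (avg (S p.1 (U p.2))
        (fun i => H p.1 (U p.2) (fun i => Z i p.2) (Z i p.2)) -
      ∫ z, H p.1 (U p.2) (fun i => Z i p.2) z ∂P) / r p.1) (whp μ) (𝓝 0) := by
  refine tendsto_whp_zero fun ε hε => ?_
  refine eventually_whp_of_and hHB (b := fun n => ENNReal.ofReal (B / (m n * (ε * |r n|) ^ 2)))
    ?_ ?_
  · rw [← ENNReal.ofReal_zero]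
    refine (ENNReal.continuous_ofReal.tendsto _).comp ?_
    have := (hr.const_mul_atTop (pow_pos hε 2)).const_div_atTop B
    refine this.congr fun n => ?_
    rw [mul_pow, sq_abs]
    ring_nf
  · filter_upwards [hr.eventually_gt_atTop 0] with n hn
    -- Positivity of `m n * r n ^ 2` excludes both degenerate cases, an empty index set and a zero
    -- rate.
    have hm : 0 < m n := by
      by_contra h
      have : m n = 0 := by omega
      simp [this] at hn
    have hr0 : r n ≠ 0 := by
      rintro h
      simp [h] at hn
    refine le_trans (measure_mono fun ω hω => ?_)
      (hZU.chebyshev hS hH hm hB (mul_pos hε (abs_pos.2 hr0)))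
    refine ⟨hω.1, ?_⟩
    have := hω.2
    rwa [not_lt, abs_div, le_div_iff₀ (abs_pos.2 hr0)] at this

/-- Conditional Markov needs only a vanishing first moment. This is essential for squared loss gaps,
which may have no second moment. -/
lemma IsSeededSample.tendsto_avg_abs (hZU : IsSeededSample μ P Z U)
    (hS : IsSeededSubset S m) (hH : IsFittedOutside H S)
    (hH0 : Tendsto (fun p : ℕ × Ω =>
      ∫⁻ z, ENNReal.ofReal |H p.1 (U p.2) (fun i => Z i p.2) z| ∂P) (whp μ) (𝓝 0)) :
    Tendsto (fun p : ℕ × Ω => avg (S p.1 (U p.2))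
        (fun i => |H p.1 (U p.2) (fun i => Z i p.2) (Z i p.2)|)) (whp μ) (𝓝 0) := by
  refine tendsto_whp_zero fun ε hε => ?_
  have hnn : ∀ p : ℕ × Ω, 0 ≤ avg (S p.1 (U p.2))
      (fun i => |H p.1 (U p.2) (fun i => Z i p.2) (Z i p.2)|) := fun p =>
    div_nonneg (Finset.sum_nonneg fun i _ => abs_nonneg _) (Nat.cast_nonneg _)
  simp only [abs_of_nonneg (hnn _)]
  have h0 : ∀ δ : ℝ≥0∞, 0 < δ → ∀ᶠ p in whp μ,
      ∫⁻ z, ENNReal.ofReal |H p.1 (U p.2) (fun i => Z i p.2) z| ∂P ≤ δ :=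
    ENNReal.tendsto_nhds_zero.1 hH0
  have hε' : ENNReal.ofReal ε ≠ 0 := by simpa using hε
  refine eventually_whp_iff.2 (ENNReal.tendsto_nhds_zero.2 fun δ hδ => ?_)
  have hδ2 : (0 : ℝ≥0∞) < δ / 2 := ENNReal.half_pos hδ.ne'
  have hδε : 0 < δ / 2 * ENNReal.ofReal ε := ENNReal.mul_pos hδ2.ne' hε'
  filter_upwards [ENNReal.tendsto_nhds_zero.1 (eventually_whp_iff.1 (h0 _ hδε)) _ hδ2] with n hn
  have hM := hZU.markov hS hH (n := n) (B := δ / 2 * ENNReal.ofReal ε) hε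
  rw [ENNReal.mul_div_cancel_right hε' ENNReal.ofReal_ne_top] at hM
  rw [← ENNReal.add_halves δ]
  refine (measure_mono fun ω hω => ?_).trans ((measure_union_le _ _).trans (add_le_add hn hM))
  by_cases h : ∫⁻ z, ENNReal.ofReal |H n (U ω) (fun i => Z i ω) z| ∂P ≤ δ / 2 * ENNReal.ofReal ε
  · exact Or.inr ⟨h, not_lt.1 hω⟩
  · exact Or.inl h

/-- The weak law of large numbers over seeded subsets. -/
lemma IsSeededSample.tendsto_avg (hZU : IsSeededSample μ P Z U)
    (hS : IsSeededSubset S m) (hm : Tendsto m atTop atTop) {f : 𝒵 → ℝ} (hf : Measurable f)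
    (hfi : Integrable f P) :
    Tendsto (fun p : ℕ × Ω => avg (S p.1 (U p.2)) (fun i => f (Z i p.2))) (whp μ)
      (𝓝 (∫ z, f z ∂P)) := by
  rw [← tendsto_sub_nhds_zero_iff]
  refine tendsto_whp_zero fun ε hε => eventually_whp_of_forall_le fun δ hδ => ?_
  have hδ2 : (0 : ℝ≥0∞) < δ / 2 := ENNReal.half_pos hδ.ne'
  have hε3 : 0 < ε / 3 := by positivity
  have hε' : ENNReal.ofReal (ε / 3) ≠ 0 := by simpa using hε
  -- A simple function has the second moment that `f` may lack, so Chebyshev applies to it. The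
  -- first tolerance keeps the two means within `ε / 3`; the second makes Markov at level `ε / 3`
  -- cost at most `δ / 2`.
  obtain ⟨g, hg, hgL⟩ := (memLp_one_iff_integrable.2 hfi).exists_simpleFunc_eLpNorm_sub_lt (by simp)
    (ε := min (ENNReal.ofReal (ε / 3)) (δ / 2 * ENNReal.ofReal (ε / 3)))
    (lt_min (pos_iff_ne_zero.2 hε') (ENNReal.mul_pos hδ2.ne' hε')).ne'
  have hg1 : ∫⁻ z, ENNReal.ofReal |f z - g z| ∂P = eLpNorm (f - ⇑g) 1 P := by
    rw [eLpNorm_one_eq_lintegral_enorm]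
    simp [Real.enorm_eq_ofReal_abs]
  have hgi : Integrable (⇑g) P := memLp_one_iff_integrable.1 hgL
  have hgm : Measurable ⇑g := g.measurable
  have hmean : |∫ z, f z ∂P - ∫ z, g z ∂P| < ε / 3 := by
    rw [← integral_sub hfi hgi, ← Real.norm_eq_abs, ← ENNReal.ofReal_lt_ofReal_iff hε3,
      ofReal_norm]
    calc _ ≤ ∫⁻ z, ‖f z - g z‖ₑ ∂P := enorm_integral_le_lintegral_enorm _
      _ = eLpNorm (f - ⇑g) 1 P := by simp [eLpNorm_one_eq_lintegral_enorm]
      _ < _ := hg.trans_le (min_le_left _ _)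
  have hmr : Tendsto (fun n => (m n : ℝ) * 1 ^ 2) atTop atTop := by
    simpa [Function.comp_def] using (tendsto_natCast_atTop_atTop (R := ℝ)).comp hm
  have hgL2 : MemLp (⇑g) 2 P := g.memLp_of_isFiniteMeasure 2 P
  have hcheb := hZU.tendsto_avg_sub_div hS (isFittedOutside_const hgm S)
    (B := ∫ z, g z ^ 2 ∂P) (integral_nonneg fun z => sq_nonneg _)
    (Eventually.of_forall fun p => (ofReal_integral_eq_lintegral_ofReal hgL2.integrable_sq
      (Eventually.of_forall fun z => sq_nonneg _)).ge) hmr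
  have hev : ∀ᶠ p in whp μ, |avg (S p.1 (U p.2)) (fun i => g (Z i p.2)) - ∫ z, g z ∂P| < ε / 3 := by
    simpa [Real.dist_eq] using Metric.tendsto_nhds.1 hcheb _ hε3
  filter_upwards [ENNReal.tendsto_nhds_zero.1 (eventually_whp_iff.1 hev) _ hδ2] with n hn
  have hM := hZU.markov hS (isFittedOutside_const (hf.sub hgm) S) (n := n)
    (B := δ / 2 * ENNReal.ofReal (ε / 3)) hε3
  rw [ENNReal.mul_div_cancel_right hε' ENNReal.ofReal_ne_top] at hM
  rw [← ENNReal.add_halves δ]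
  refine (measure_mono fun ω hω => ?_).trans ((measure_union_le _ _).trans (add_le_add hn hM))
  by_contra hcon
  simp only [Set.mem_union, Set.mem_ofPred_eq, not_or, not_not, Pi.sub_apply, hg1, not_and,
    not_le] at hcon hω
  refine hω ?_
  have h1 := hcon.1
  have h2 := hcon.2 (hg.le.trans (min_le_right _ _))
  have h3 : |avg (S n (U ω)) (fun i => f (Z i ω)) - avg (S n (U ω)) (fun i => g (Z i ω))| ≤
      avg (S n (U ω)) (fun i => |f (Z i ω) - g (Z i ω)|) := by
    simp only [avg, ← sub_div, ← Finset.sum_sub_distrib]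
    rw [abs_div, Nat.abs_cast]
    gcongr
    exact Finset.abs_sum_le_sum_abs _ _
  rw [abs_lt] at *
  have := abs_le.1 h3
  constructor <;> linarith

end Prob

end Sampling

/-! ### Second moments and averages -/

section Moments

variable {𝒵 : Type*} [MeasurableSpace 𝒵] {P : Measure 𝒵}

lemma memLp_two_of_lintegral_sq_le {f : 𝒵 → ℝ} (hf : Measurable f) {B : ℝ}
    (h : ∫⁻ z, ENNReal.ofReal (f z ^ 2) ∂P ≤ ENNReal.ofReal B) : MemLp f 2 P := by
  refine (memLp_two_iff_integrable_sq hf.aestronglyMeasurable).2 ⟨by fun_prop, ?_⟩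
  rw [hasFiniteIntegral_iff_ofReal (Eventually.of_forall fun z => sq_nonneg _)]
  exact h.trans_lt ENNReal.ofReal_lt_top

lemma lintegral_sq_eq_ofReal {f : 𝒵 → ℝ} (hf : MemLp f 2 P) :
    ∫⁻ z, ENNReal.ofReal (f z ^ 2) ∂P = ENNReal.ofReal (∫ z, f z ^ 2 ∂P) :=
  (ofReal_integral_eq_lintegral_ofReal hf.integrable_sq
    (Eventually.of_forall fun _ => sq_nonneg _)).symm

/-- Nonnegativity of the variance of `f - o` is the inequality `(E W)² ≤ E W²`. -/
lemma abs_integral_sub_le_of_lintegral_sq_le [IsProbabilityMeasure P] {f o : 𝒵 → ℝ} (hf : Measurable f) (ho : Measurable o)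
    (hoL : MemLp o 2 P) {ε : ℝ} (hε : 0 ≤ ε)
    (h : ∫⁻ z, ENNReal.ofReal ((f z - o z) ^ 2) ∂P ≤ ENNReal.ofReal (ε ^ 2)) :
    MemLp f 2 P ∧ |∫ z, f z ∂P - ∫ z, o z ∂P| ≤ ε := by
  have hL : MemLp (fun z => f z - o z) 2 P := memLp_two_of_lintegral_sq_le (hf.sub ho) h
  have hfL : MemLp f 2 P := by
    have := hL.add hoL
    refine this.ae_eq (Eventually.of_forall fun z => ?_)
    simp
  refine ⟨hfL, ?_⟩
  rw [← integral_sub (hfL.integrable one_le_two) (hoL.integrable one_le_two)]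
  refine abs_le_of_sq_le_sq ?_ hε
  rw [lintegral_sq_eq_ofReal hL, ENNReal.ofReal_le_ofReal_iff (sq_nonneg _)] at h
  have := variance_nonneg (fun z => f z - o z) P
  rw [variance_eq_sub hL] at this
  simp only [Pi.pow_apply] at this
  linarith

/-- Pointwise, `2 o² + 2 (f - o)² - f² = (f - 2 o)²`. -/
lemma lintegral_sq_le_of_sub {f o : 𝒵 → ℝ} (hf : Measurable f) (ho : Measurable o)
    (hoL : MemLp o 2 P) (h : ∫⁻ z, ENNReal.ofReal ((f z - o z) ^ 2) ∂P ≤ 1) :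
    ∫⁻ z, ENNReal.ofReal (f z ^ 2) ∂P ≤ ENNReal.ofReal (2 * ∫ z, o z ^ 2 ∂P + 2) := by
  calc _ ≤ ∫⁻ z, (2 * ENNReal.ofReal (o z ^ 2) + 2 * ENNReal.ofReal ((f z - o z) ^ 2)) ∂P := by
        refine lintegral_mono fun z => ?_
        rw [← ENNReal.ofReal_ofNat 2, ← ENNReal.ofReal_mul (by norm_num),
          ← ENNReal.ofReal_mul (by norm_num), ← ENNReal.ofReal_add (by positivity) (by positivity)]
        exact ENNReal.ofReal_le_ofReal (by nlinarith [sq_nonneg (f z - 2 * o z)])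
    _ = 2 * ENNReal.ofReal (∫ z, o z ^ 2 ∂P) +
        2 * ∫⁻ z, ENNReal.ofReal ((f z - o z) ^ 2) ∂P := by
        rw [lintegral_add_left (by fun_prop), lintegral_const_mul _ (by fun_prop),
          lintegral_const_mul _ (by fun_prop), lintegral_sq_eq_ofReal hoL]
    _ ≤ 2 * ENNReal.ofReal (∫ z, o z ^ 2 ∂P) + 2 * 1 := by gcongr
    _ = _ := by
        rw [ENNReal.ofReal_add (by positivity) (by norm_num), ENNReal.ofReal_mul (by norm_num)]
        simp

end Moments

section Avg

variable {ι : Type*} (S : Finset ι)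

lemma avg_sq_sub_avg (hS : S.Nonempty) (f : ι → ℝ) :
    avg S (fun i => (f i - avg S f) ^ 2) = avg S (fun i => f i ^ 2) - avg S f ^ 2 := by
  have hm : (S.card : ℝ) ≠ 0 := by exact_mod_cast hS.card_pos.ne'
  have h1 : ∑ i ∈ S, f i = S.card * avg S f := by rw [avg]; field_simp
  have h2 : ∑ i ∈ S, (f i - avg S f) ^ 2 =
      ∑ i ∈ S, f i ^ 2 - 2 * avg S f * ∑ i ∈ S, f i + S.card * avg S f ^ 2 := by
    simp only [sub_sq, Finset.sum_add_distrib, Finset.sum_sub_distrib, Finset.sum_const,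
      nsmul_eq_mul, Finset.mul_sum]
    congr 2
    exact Finset.sum_congr rfl fun i _ => by ring
  have h3 : avg S (fun i => f i ^ 2) = (∑ i ∈ S, f i ^ 2) / S.card := rfl
  rw [avg, h2, h1, h3]
  field_simp
  ring

/-- Expand `f² - o² = 2 o (f - o) + (f - o)²` and apply Cauchy–Schwarz to the cross term. The
absolute values on squares match the form of `tendsto_avg_abs`. -/
lemma abs_avg_sq_sub_le (f o : ι → ℝ) :
    |avg S (fun i => f i ^ 2) - avg S (fun i => o i ^ 2)| ≤
      2 * √(avg S (fun i => o i ^ 2)) * √(avg S fun i => |(f i - o i) ^ 2|) +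
        avg S fun i => |(f i - o i) ^ 2| := by
  simp only [abs_sq]
  have hm : (0 : ℝ) ≤ S.card := Nat.cast_nonneg _
  have h1 : avg S (fun i => f i ^ 2) - avg S (fun i => o i ^ 2) =
      2 * ((∑ i ∈ S, o i * (f i - o i)) / S.card) + avg S fun i => (f i - o i) ^ 2 := by
    simp only [avg, ← sub_div, ← Finset.sum_sub_distrib, mul_div_assoc', ← add_div,
      Finset.mul_sum, ← Finset.sum_add_distrib]
    congr 1
    exact Finset.sum_congr rfl fun i _ => by ring
  have h2 : |(∑ i ∈ S, o i * (f i - o i)) / S.card| ≤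
      √(avg S (fun i => o i ^ 2)) * √(avg S fun i => (f i - o i) ^ 2) := by
    have h0 : 0 ≤ avg S fun i => o i ^ 2 :=
      div_nonneg (Finset.sum_nonneg fun i _ => sq_nonneg _) hm
    rw [← Real.sqrt_mul h0]
    refine Real.abs_le_sqrt ?_
    rw [avg, avg, div_mul_div_comm, div_pow, ← pow_two]
    gcongr
    exact Finset.sum_mul_sq_le_sq_mul_sq S _ _
  rw [h1]
  refine (abs_add_le _ _).trans (add_le_add ?_ (abs_of_nonneg ?_).le)
  · rw [abs_mul, abs_two, mul_assoc]
    gcongr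
  · exact div_nonneg (Finset.sum_nonneg fun i _ => sq_nonneg _) hm

end Avg

/-! ### Held-out averages of fitted functions that converge in `L₂(P)` -/

section Approximation

variable {Ω 𝒰 𝒵 : Type*} [MeasurableSpace Ω] [MeasurableSpace 𝒰] [MeasurableSpace 𝒵]
  {μ : Measure Ω} {P : Measure 𝒵} {Z : ℕ → Ω → 𝒵} {U : Ω → 𝒰}
  {H : (n : ℕ) → 𝒰 → (Fin n → 𝒵) → 𝒵 → ℝ} {o : 𝒵 → ℝ}
  {S : (n : ℕ) → 𝒰 → Finset (Fin n)} {m : ℕ → ℕ}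

variable (μ P Z U) in
/-- The fitted functions `H` approach `o` in `L₂(P)`, in probability. -/
def ApproachesInL2 (H : (n : ℕ) → 𝒰 → (Fin n → 𝒵) → 𝒵 → ℝ) (o : 𝒵 → ℝ) : Prop :=
  Tendsto (fun p : ℕ × Ω =>
    ∫⁻ z, ENNReal.ofReal ((H p.1 (U p.2) (fun i => Z i p.2) z - o z) ^ 2) ∂P) (whp μ) (𝓝 0)

variable (P Z U) in
/-- The mean of the fitted function under a fresh draw. -/
def fitMean (H : (n : ℕ) → 𝒰 → (Fin n → 𝒵) → 𝒵 → ℝ) (p : ℕ × Ω) : ℝ :=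
  ∫ z, H p.1 (U p.2) (fun i => Z i p.2) z ∂P

lemma ApproachesInL2.eventually_lintegral_sq_le (h : ApproachesInL2 μ P Z U H o)
    (hH : IsFittedOutside H S) (ho : Measurable o) (hoL : MemLp o 2 P) :
    ∀ᶠ p in whp μ, ∫⁻ z, ENNReal.ofReal (H p.1 (U p.2) (fun i => Z i p.2) z ^ 2) ∂P ≤
      ENNReal.ofReal (2 * ∫ z, o z ^ 2 ∂P + 2) := by
  filter_upwards [ENNReal.tendsto_nhds_zero.1 h 1 one_pos] with p hp
  exact lintegral_sq_le_of_sub (hH.measurable_section _ _ _) ho hoL hp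

variable [IsProbabilityMeasure P]

lemma ApproachesInL2.eventually_fitMean (h : ApproachesInL2 μ P Z U H o)
    (hH : IsFittedOutside H S) (ho : Measurable o) (hoL : MemLp o 2 P) {ε : ℝ} (hε : 0 < ε) :
    ∀ᶠ p in whp μ, MemLp (H p.1 (U p.2) fun i => Z i p.2) 2 P ∧
      |fitMean P Z U H p - ∫ z, o z ∂P| ≤ ε := by
  filter_upwards [ENNReal.tendsto_nhds_zero.1 h (ENNReal.ofReal (ε ^ 2)) (by positivity)] with p hp
  exact abs_integral_sub_le_of_lintegral_sq_le (hH.measurable_section _ _ _) ho hoL hε.le hp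

lemma ApproachesInL2.tendsto_fitMean (h : ApproachesInL2 μ P Z U H o)
    (hH : IsFittedOutside H S) (ho : Measurable o) (hoL : MemLp o 2 P) :
    Tendsto (fitMean P Z U H) (whp μ) (𝓝 (∫ z, o z ∂P)) := by
  rw [← tendsto_sub_nhds_zero_iff]
  refine tendsto_whp_zero fun ε hε => ?_
  filter_upwards [h.eventually_fitMean hH ho hoL (half_pos hε)] with p hp
  linarith [hp.2]

variable [IsProbabilityMeasure μ]

/-- Averages of the fitted function over its test observations, at the rate `r`. -/
lemma ApproachesInL2.tendsto_avg_rate (h : ApproachesInL2 μ P Z U H o)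
    (hH : IsFittedOutside H S) (ho : Measurable o) (hoL : MemLp o 2 P)
    (hZU : IsSeededSample μ P Z U) (hS : IsSeededSubset S m) {r : ℕ → ℝ}
    (hr : Tendsto (fun n => (m n : ℝ) * r n ^ 2) atTop atTop)
    (hmean : Tendsto (fun p => (fitMean P Z U H p - ∫ z, o z ∂P) / r p.1) (whp μ) (𝓝 0)) :
    Tendsto (fun p : ℕ × Ω => (avg (S p.1 (U p.2))
      (fun i => H p.1 (U p.2) (fun i => Z i p.2) (Z i p.2)) - ∫ z, o z ∂P) / r p.1) (whp μ)
      (𝓝 0) := by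
  -- Noise around the mean given the fit; the bias of that mean is `hmean`.
  have h1 := hZU.tendsto_avg_sub_div hS hH (by positivity)
    (h.eventually_lintegral_sq_le hH ho hoL) hr
  have h2 := h1.add hmean
  rw [add_zero] at h2
  refine h2.congr fun p => ?_
  rw [← add_div, fitMean]
  ring

lemma ApproachesInL2.tendsto_avg (h : ApproachesInL2 μ P Z U H o)
    (hH : IsFittedOutside H S) (ho : Measurable o) (hoL : MemLp o 2 P)
    (hZU : IsSeededSample μ P Z U) (hS : IsSeededSubset S m) (hm : Tendsto m atTop atTop) :
    Tendsto (fun p : ℕ × Ω => avg (S p.1 (U p.2))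
      (fun i => H p.1 (U p.2) (fun i => Z i p.2) (Z i p.2))) (whp μ) (𝓝 (∫ z, o z ∂P)) := by
  rw [← tendsto_sub_nhds_zero_iff]
  have hmr : Tendsto (fun n => (m n : ℝ) * 1 ^ 2) atTop atTop := by
    simpa [Function.comp_def] using (tendsto_natCast_atTop_atTop (R := ℝ)).comp hm
  have hmean := tendsto_sub_nhds_zero_iff.2 (h.tendsto_fitMean hH ho hoL)
  simpa using h.tendsto_avg_rate hH ho hoL hZU hS (r := fun _ => 1) hmr (by simpa using hmean)

/-- Fourth moments are not available, so Chebyshev cannot be applied to the squares. The law of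
large numbers is used for the integrable `o²`, and the passage from `H²` to `o²` costs only averages
of `(H - o)²`. -/
lemma ApproachesInL2.tendsto_avg_sq (h : ApproachesInL2 μ P Z U H o)
    (hH : IsFittedOutside H S) (ho : Measurable o) (hoL : MemLp o 2 P)
    (hZU : IsSeededSample μ P Z U) (hS : IsSeededSubset S m) (hm : Tendsto m atTop atTop) :
    Tendsto (fun p : ℕ × Ω => avg (S p.1 (U p.2))
      (fun i => H p.1 (U p.2) (fun i => Z i p.2) (Z i p.2) ^ 2)) (whp μ)
      (𝓝 (∫ z, o z ^ 2 ∂P)) := by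
  have ho2 : Measurable fun z => o z ^ 2 := ho.pow_const 2
  have horacle := hZU.tendsto_avg hS hm ho2 hoL.integrable_sq
  have hφ : Measurable fun w : 𝒵 × ℝ => (w.2 - o w.1) ^ 2 := by fun_prop
  have hgap := hZU.tendsto_avg_abs hS (hH.comp (φ := fun z t => (t - o z) ^ 2) hφ) (by
    simp only [abs_sq]
    exact h)
  have hb := ((horacle.sqrt.const_mul 2).mul hgap.sqrt).add hgap
  rw [Real.sqrt_zero, mul_zero, add_zero] at hb
  have hdiff : Tendsto (fun p : ℕ × Ω => avg (S p.1 (U p.2))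
      (fun i => H p.1 (U p.2) (fun i => Z i p.2) (Z i p.2) ^ 2) -
        avg (S p.1 (U p.2)) fun i => o (Z i p.2) ^ 2) (whp μ) (𝓝 0) :=
    squeeze_zero_norm (fun p => abs_avg_sq_sub_le (S p.1 (U p.2))
      (fun i => H p.1 (U p.2) (fun i => Z i p.2) (Z i p.2)) fun i => o (Z i p.2)) hb
  have hsq := hdiff.add horacle
  simp only [sub_add_cancel, zero_add] at hsq
  exact hsq

/-- The sample variances of the fitted function are consistent. -/
lemma ApproachesInL2.tendsto_sampleVariance (h : ApproachesInL2 μ P Z U H o)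
    (hH : IsFittedOutside H S) (ho : Measurable o) (hoL : MemLp o 2 P)
    (hZU : IsSeededSample μ P Z U) (hS : IsSeededSubset S m) (hm : Tendsto m atTop atTop) :
    Tendsto (fun p : ℕ × Ω => avg (S p.1 (U p.2)) fun i =>
      (H p.1 (U p.2) (fun i => Z i p.2) (Z i p.2) - avg (S p.1 (U p.2)) fun i =>
        H p.1 (U p.2) (fun i => Z i p.2) (Z i p.2)) ^ 2) (whp μ) (𝓝 (Var[o; P])) := by
  rw [variance_eq_sub hoL]
  refine ((h.tendsto_avg_sq hH ho hoL hZU hS hm).sub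
    ((h.tendsto_avg hH ho hoL hZU hS hm).pow 2)).congr' ?_
  filter_upwards [tendsto_fst_whp.eventually (hm.eventually_gt_atTop 0)] with p hp
  rw [avg_sq_sub_avg]
  rw [← Finset.card_pos, hS.card_eq]
  exact hp

end Approximation

/-! ### Curvature and the order of the predictiveness -/

section Population

variable {D q : ℕ} {𝒳 : Type*}

lemma oracleLoss_nonneg (g : Rep D → Resp q) (z : Full D 𝒳 q) : 0 ≤ oracleLoss g z := sq_nonneg _

variable [MeasurableSpace 𝒳]
  {P : Measure (Full D 𝒳 q)} {𝒢 : Set (Rep D → Resp q)}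

/-- If every radius `1 / (j + 1)` admitted a counterexample, these would form a sequence that
violates the curvature condition. The uniform version can be applied to a random fit, outcome by
outcome. -/
lemma RiskCurvature.exists_forall {N : (Full D 𝒳 q → Resp q) → ℝ≥0∞} {g₀ : Rep D → Resp q} {d : ℕ}
    (h : RiskCurvature P 𝒢 N g₀ d) : ∃ C > 0, ∃ δ > 0, ∀ (φ : 𝒳 → Rep D) (g : Rep D → Resp q),
      Measurable φ → g ∈ subclass 𝒢 d → N (ruleGap φ g g₀) ≤ ENNReal.ofReal δ →
      ENNReal.ofReal |∫ z, (plugInLoss φ g z - oracleLoss g₀ z) ∂P| ≤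
        ENNReal.ofReal C * N (ruleGap φ g g₀) ^ 2 := by
  obtain ⟨C, hC, h⟩ := h
  refine ⟨C, hC, ?_⟩
  by_contra! hcon
  choose φ g hφ hg hN hlt using fun j : ℕ => hcon (1 / ((j : ℝ) + 1)) Nat.one_div_pos_of_nat
  have hlim : Tendsto (fun j => N (ruleGap (φ j) (g j) g₀)) atTop (𝓝 0) := by
    refine tendsto_of_tendsto_of_tendsto_of_le_of_le tendsto_const_nhds ?_ (fun _ => zero_le) hN
    simpa [Function.comp_def] using (ENNReal.continuous_ofReal.tendsto _).comp
      (tendsto_one_div_add_atTop_nhds_zero_nat (𝕜 := ℝ))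
  obtain ⟨j, hj⟩ := (h φ g hφ hg hlim).exists
  exact (hlt j).not_ge hj

lemma subclass_mono {d e : ℕ} (h : d ≤ e) : subclass 𝒢 d ⊆ subclass 𝒢 e :=
  fun _ hg => ⟨hg.1, fun r r' hr => hg.2 r r' fun j hj => hr j (hj.trans_le h)⟩

lemma predictiveness_anti {d e : ℕ} (h : d ≤ e) : predictiveness P 𝒢 e ≤ predictiveness P 𝒢 d :=
  biInf_mono (subclass_mono h)

lemma targetOrder_spec : targetOrder P 𝒢 ≤ D ∧
    predictiveness P 𝒢 (targetOrder P 𝒢) = predictiveness P 𝒢 D :=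
  Nat.sInf_mem (s := {d | d ≤ D ∧ predictiveness P 𝒢 d = predictiveness P 𝒢 D}) ⟨D, le_rfl, rfl⟩

/-- The classes are nested, and equality would contradict the minimality of the target order. -/
lemma predictiveness_lt {d : ℕ} (h : d < targetOrder P 𝒢) :
    predictiveness P 𝒢 (targetOrder P 𝒢) < predictiveness P 𝒢 d := by
  have hD := h.le.trans targetOrder_spec.1
  refine lt_of_le_of_ne (predictiveness_anti h.le) fun heq => Nat.notMem_of_lt_sInf h ⟨hD, ?_⟩
  rw [← heq, targetOrder_spec.2]

lemma measurable_sqLoss : Measurable fun w : Resp q × Resp q => sqLoss w.1 w.2 := by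
  unfold sqLoss
  fun_prop

lemma measurable_oracleLoss {g : Rep D → Resp q} (hg : Measurable g) :
    Measurable (oracleLoss (𝒳 := 𝒳) g) :=
  measurable_sqLoss.comp (f := fun z : Full D 𝒳 q => (z.2.2, g z.1)) (by fun_prop)

lemma integral_oracleLoss_lt {g₀ g₁ : Rep D → Resp q} (h₀ : Integrable (oracleLoss (𝒳 := 𝒳) g₀) P)
    (h₁ : Integrable (oracleLoss (𝒳 := 𝒳) g₁) P) (h : risk P g₀ < risk P g₁) :
    ∫ z, oracleLoss g₀ z ∂P < ∫ z, oracleLoss g₁ z ∂P := by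
  have hr : ∀ g : Rep D → Resp q, Integrable (oracleLoss (𝒳 := 𝒳) g) P →
      risk P g = ENNReal.ofReal (∫ z, oracleLoss g z ∂P) := fun g hg =>
    (ofReal_integral_eq_lintegral_ofReal hg (Eventually.of_forall (oracleLoss_nonneg g))).symm
  rw [hr _ h₀, hr _ h₁] at h
  exact (ENNReal.ofReal_lt_ofReal_iff_of_nonneg (integral_nonneg (oracleLoss_nonneg g₀))).1 h

end Population

namespace Procedure

variable {D q K : ℕ} {𝒳 𝒰 Ω : Type*} [MeasurableSpace 𝒳] [MeasurableSpace 𝒰] [MeasurableSpace Ω]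
  {𝒢 : Set (Rep D → Resp q)} (A : Procedure D q K 𝒳 𝒰 𝒢)

/-! ### Sizes of the folds and of their parts -/

lemma isSeededSubset_of_mem_iff {S : (n : ℕ) → 𝒰 → Finset (Fin n)} {m : ℕ → ℕ}
    (W : Set (Fin K × Fin 3)) (hW : ∀ n u i, i ∈ S n u ↔ A.split n u i ∈ W)
    (hm : ∀ n u, (S n u).card = m n) : IsSeededSubset S m := by
  refine ⟨hm, fun n i => ?_⟩
  have h : Measurable fun u => A.split n u i := (measurable_pi_apply i).comp (A.measurable_split n)
  simp only [hW]
  exact h (Set.toFinite W).measurableSet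

lemma isSeededSubset_part_zero (k : Fin K) :
    IsSeededSubset (fun n u => A.part n u k 0) fun n => A.sizeA n k :=
  A.isSeededSubset_of_mem_iff {(k, 0)} (fun n u i => by simp [part]) fun n u => A.card_a n u k

lemma isSeededSubset_part_one (k : Fin K) :
    IsSeededSubset (fun n u => A.part n u k 1) fun n => A.sizeA n k :=
  A.isSeededSubset_of_mem_iff {(k, 1)} (fun n u i => by simp [part]) fun n u => A.card_b n u k

lemma isSeededSubset_part_two (k : Fin K) :
    IsSeededSubset (fun n u => A.part n u k 2) fun n => A.sizeO n k :=
  A.isSeededSubset_of_mem_iff {(k, 2)} (fun n u i => by simp [part]) fun n u => A.card_o n u k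

lemma part_subset_fold (n : ℕ) (u : 𝒰) (k : Fin K) (J : Fin 3) : A.part n u k J ⊆ A.fold n u k := by
  intro i hi
  simp only [part, fold, Finset.mem_filter] at hi ⊢
  simp [hi.2]

lemma card_fold (n : ℕ) (u : 𝒰) (k : Fin K) :
    (A.fold n u k).card = 2 * A.sizeA n k + A.sizeO n k := by
  have h : (A.fold n u k).card = ∑ J : Fin 3, (A.part n u k J).card := by
    rw [Finset.card_eq_sum_card_fiberwise (f := fun i => (A.split n u i).2) (t := Finset.univ)
      (by simp)]
    refine Finset.sum_congr rfl fun J _ => congrArg Finset.card ?_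
    ext i
    simp [fold, part, Prod.ext_iff]
  rw [h, Fin.sum_univ_three]
  have := A.card_a n u k
  have := A.card_b n u k
  have := A.card_o n u k
  unfold part
  omega

lemma isSeededSubset_fold (k : Fin K) :
    IsSeededSubset (fun n u => A.fold n u k) fun n => 2 * A.sizeA n k + A.sizeO n k :=
  A.isSeededSubset_of_mem_iff {p | p.1 = k} (fun n u i => by simp [fold]) fun n u =>
    A.card_fold n u k

lemma isSeededSubset_train (k : Fin K) :
    IsSeededSubset (fun n u => A.train n u k) fun n => n - (2 * A.sizeA n k + A.sizeO n k) := by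
  refine A.isSeededSubset_of_mem_iff {p | p.1 ≠ k} (fun n u i => by simp [train]) fun n u => ?_
  rw [← A.card_fold n u k]
  have := Finset.card_filter_add_card_filter_not (s := (Finset.univ : Finset (Fin n)))
    (fun i => (A.split n u i).1 = k)
  rw [Finset.card_univ, Fintype.card_fin] at this
  simp only [fold, train, ne_eq]
  omega

section Sizes

variable {A} {τ : ℝ} {k : Fin K}

lemma tendsto_size_fold
    (hfold : Tendsto (fun n : ℕ => (2 * A.sizeA n k + A.sizeO n k : ℝ) / n) atTop
      (𝓝 (1 / (K : ℝ))))
    (hK : 2 ≤ K) :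
    Tendsto (fun n => 2 * A.sizeA n k + A.sizeO n k) atTop atTop := by
  have hK0 : (0 : ℝ) < 1 / K := by positivity
  rw [← tendsto_natCast_atTop_iff (R := ℝ)]
  refine (hfold.pos_mul_atTop hK0 tendsto_natCast_atTop_atTop).congr' ?_
  filter_upwards [eventually_gt_atTop 0] with n hn
  have : (n : ℝ) ≠ 0 := by exact_mod_cast hn.ne'
  push_cast
  field_simp

lemma tendsto_size_train
    (hfold : Tendsto (fun n : ℕ => (2 * A.sizeA n k + A.sizeO n k : ℝ) / n) atTop
      (𝓝 (1 / (K : ℝ))))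
    (hK : 2 ≤ K) :
    Tendsto (fun n => n - (2 * A.sizeA n k + A.sizeO n k)) atTop atTop := by
  have hK0 : 0 < 1 - (1 : ℝ) / K := by
    have : (2 : ℝ) ≤ K := by exact_mod_cast hK
    rw [sub_pos, div_lt_one (by linarith)]
    linarith
  rw [← tendsto_natCast_atTop_iff (R := ℝ)]
  have h := (hfold.const_sub 1).pos_mul_atTop hK0 tendsto_natCast_atTop_atTop
  refine tendsto_atTop_mono' _ ?_ h
  filter_upwards [eventually_gt_atTop 0] with n hn
  have : (n : ℝ) ≠ 0 := by exact_mod_cast hn.ne'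
  have h2 : (n : ℝ) ≤ ((n - (2 * A.sizeA n k + A.sizeO n k) : ℕ) : ℝ) +
      (2 * A.sizeA n k + A.sizeO n k) := by
    have : n ≤ n - (2 * A.sizeA n k + A.sizeO n k) + (2 * A.sizeA n k + A.sizeO n k) := by omega
    exact_mod_cast this
  have h3 : (1 - (2 * A.sizeA n k + A.sizeO n k : ℝ) / n) * n =
      n - (2 * A.sizeA n k + A.sizeO n k) := by field_simp
  rw [h3]
  linarith

/-- With `ρ` the overlap ratio, the shares within a fold are `(1 - ρ) / (2 - ρ)` and `ρ / (2 - ρ)`.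
-/
lemma tendsto_size_div
    (hfold : Tendsto (fun n : ℕ => (2 * A.sizeA n k + A.sizeO n k : ℝ) / n) atTop
      (𝓝 (1 / (K : ℝ))))
    (hoverlap : Tendsto
      (fun n : ℕ => (A.sizeO n k : ℝ) / (A.sizeA n k + A.sizeO n k)) atTop (𝓝 τ))
    (hK : 2 ≤ K) (hτ1 : τ < 1) :
    Tendsto (fun n : ℕ => (A.sizeA n k : ℝ) / n) atTop (𝓝 ((1 - τ) / (2 - τ) * (1 / K))) ∧
    Tendsto (fun n : ℕ => (A.sizeO n k : ℝ) / n) atTop (𝓝 (τ / (2 - τ) * (1 / K))) := by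
  have hpos : ∀ᶠ n in atTop, 0 < 2 * A.sizeA n k + A.sizeO n k :=
    (tendsto_size_fold hfold hK).eventually_gt_atTop 0
  have h2 : (2 - τ) ≠ 0 := by linarith
  constructor
  · refine (((hoverlap.const_sub 1).div (hoverlap.const_sub 2) h2).mul hfold).congr' ?_
    filter_upwards [hpos, eventually_gt_atTop 0] with n hn hn0
    have hn' : (0 : ℝ) < 2 * A.sizeA n k + A.sizeO n k := by exact_mod_cast hn
    have hs : (0 : ℝ) < A.sizeA n k + A.sizeO n k := by
      have : 0 < A.sizeA n k + A.sizeO n k := by omega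
      exact_mod_cast this
    have hn0' : (n : ℝ) ≠ 0 := by exact_mod_cast hn0.ne'
    have e1 : (1 : ℝ) - A.sizeO n k / (A.sizeA n k + A.sizeO n k) =
        A.sizeA n k / (A.sizeA n k + A.sizeO n k) := by field_simp; ring
    have e2 : (2 : ℝ) - A.sizeO n k / (A.sizeA n k + A.sizeO n k) =
        (2 * A.sizeA n k + A.sizeO n k) / (A.sizeA n k + A.sizeO n k) := by field_simp; ring
    simp only [Pi.div_apply]
    rw [e1, e2, div_div_div_cancel_right₀ hs.ne', div_mul_div_cancel₀ hn'.ne']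
  · refine ((hoverlap.div (hoverlap.const_sub 2) h2).mul hfold).congr' ?_
    filter_upwards [hpos, eventually_gt_atTop 0] with n hn hn0
    have hn' : (0 : ℝ) < 2 * A.sizeA n k + A.sizeO n k := by exact_mod_cast hn
    have hs : (0 : ℝ) < A.sizeA n k + A.sizeO n k := by
      have : 0 < A.sizeA n k + A.sizeO n k := by omega
      exact_mod_cast this
    have hn0' : (n : ℝ) ≠ 0 := by exact_mod_cast hn0.ne'
    have e2 : (2 : ℝ) - A.sizeO n k / (A.sizeA n k + A.sizeO n k) =
        (2 * A.sizeA n k + A.sizeO n k) / (A.sizeA n k + A.sizeO n k) := by field_simp; ring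
    simp only [Pi.div_apply]
    rw [e2, div_div_div_cancel_right₀ hs.ne', div_mul_div_cancel₀ hn'.ne']

end Sizes

/-! ### Fitted losses -/

/-- The fitted map `φ̂_{-k}` on the complete draws. -/
def fitReduce (n : ℕ) (u : 𝒰) (k : Fin K) (z : Fin n → Full D 𝒳 q) : 𝒳 → Rep D :=
  A.reduce n u k fun i => (z i).2

/-- The fitted rule `ĝ_{-k;d}` on the complete draws. -/
def fitRule (n : ℕ) (u : 𝒰) (k : Fin K) (d : ℕ) (z : Fin n → Full D 𝒳 q) : Rep D → Resp q :=
  A.rule n u k d fun i => (z i).2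

/-- The loss of the fitted predictor, as a function of a fresh draw. -/
def fitLoss (k : Fin K) (d n : ℕ) (u : 𝒰) (z : Fin n → Full D 𝒳 q) : Full D 𝒳 q → ℝ :=
  plugInLoss (A.fitReduce n u k z) (A.fitRule n u k d z)

lemma loss_eq_fitLoss (n : ℕ) (u : 𝒰) (z : Fin n → Full D 𝒳 q) (k : Fin K) (d : ℕ) :
    A.loss n u (fun i => (z i).2) k d = fun i => A.fitLoss k d n u z (z i) := rfl

lemma measurable_fitReduce (n : ℕ) (u : 𝒰) (k : Fin K) (z : Fin n → Full D 𝒳 q) :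
    Measurable (A.fitReduce n u k z) :=
  (A.measurable_reduce n k).comp (f := fun x => (u, (fun i => (z i).2), x)) (by fun_prop)

/-- The fit ignores the whole fold, hence also each part of it; the contrast uses the parts and the
variance estimate uses the fold. -/
lemma isFittedOutside_fitLoss (k : Fin K) {d : ℕ} (hd : d ≤ D)
    {S : (n : ℕ) → 𝒰 → Finset (Fin n)} (hS : ∀ n u, S n u ⊆ A.fold n u k) :
    IsFittedOutside (A.fitLoss k d) S := by
  refine ⟨fun n => ?_, fun n u x y hxy => ?_⟩
  · have h1 : Measurable fun w : 𝒰 × (Fin n → Full D 𝒳 q) × Full D 𝒳 q =>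
        A.fitReduce n w.1 k w.2.1 w.2.2.2.1 :=
      (A.measurable_reduce n k).comp (f := fun w : 𝒰 × (Fin n → Full D 𝒳 q) × Full D 𝒳 q =>
        (w.1, (fun i => (w.2.1 i).2), w.2.2.2.1)) (by fun_prop)
    have h2 : Measurable fun w : 𝒰 × (Fin n → Full D 𝒳 q) × Full D 𝒳 q =>
        A.fitRule n w.1 k d w.2.1 (A.fitReduce n w.1 k w.2.1 w.2.2.2.1) :=
      (A.measurable_rule n k d hd).comp (f := fun w : 𝒰 × (Fin n → Full D 𝒳 q) × Full D 𝒳 q =>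
        (w.1, (fun i => (w.2.1 i).2), A.fitReduce n w.1 k w.2.1 w.2.2.2.1)) (by fun_prop)
    exact measurable_sqLoss.comp (f := fun w : 𝒰 × (Fin n → Full D 𝒳 q) × Full D 𝒳 q =>
      (w.2.2.2.2, A.fitRule n w.1 k d w.2.1 (A.fitReduce n w.1 k w.2.1 w.2.2.2.1))) (by fun_prop)
  · have hxy' : ∀ i ∈ {i | (A.split n u i).1 ≠ k}, (x i).2 = (y i).2 := fun i hi => by
      rw [hxy i fun h => hi (by simpa [fold] using hS n u h)]
    unfold fitLoss fitReduce fitRule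
    rw [A.reduce_train n u k hxy', A.rule_train n u k d hxy']

end Procedure

/-! ### The sample mean as the fitted rule of order zero -/

/-- The triangle inequality gives `|s² - t²| ≤ b² + 2 t b`, which is then squared. The bound is
linear in the loss at `c`, so it can be integrated. -/
lemma sq_sqLoss_sub_le {q : ℕ} (y a c : Resp q) :
    (sqLoss y a - sqLoss y c) ^ 2 ≤ 2 * (‖a - c‖ ^ 2) ^ 2 + 8 * ‖a - c‖ ^ 2 * sqLoss y c := by
  unfold sqLoss
  have h1 : ‖y - a‖ ≤ ‖y - c‖ + ‖a - c‖ := by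
    rw [norm_sub_rev a c, show y - a = y - c + (c - a) by abel]
    exact norm_add_le _ _
  have h2 : ‖y - c‖ ≤ ‖y - a‖ + ‖a - c‖ := by
    rw [show y - c = y - a + (a - c) by abel]
    exact norm_add_le _ _
  have h0 := norm_nonneg (y - a)
  have h0' := norm_nonneg (y - c)
  have h0'' := norm_nonneg (a - c)
  generalize ‖y - a‖ = s at *
  generalize ‖y - c‖ = t at *
  generalize ‖a - c‖ = b at *
  have h3 : |s ^ 2 - t ^ 2| ≤ b ^ 2 + 2 * t * b := by
    rw [abs_le]
    constructor <;> nlinarith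
  calc (s ^ 2 - t ^ 2) ^ 2 = |s ^ 2 - t ^ 2| ^ 2 := (sq_abs _).symm
    _ ≤ (b ^ 2 + 2 * t * b) ^ 2 := by gcongr
    _ ≤ _ := by nlinarith [sq_nonneg (b ^ 2 - 2 * t * b)]

section SampleMean

variable {D q : ℕ} {𝒳 𝒰 Ω : Type*} [MeasurableSpace 𝒳] [MeasurableSpace 𝒰] [MeasurableSpace Ω]
  {μ : Measure Ω} [IsProbabilityMeasure μ] {P : Measure (Full D 𝒳 q)} [IsProbabilityMeasure P]
  {Z : ℕ → Ω → Full D 𝒳 q} {U : Ω → 𝒰}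

/-- Integrability follows from `s ≤ s² + 1`. The centre `c` is arbitrary, so the mean may be
inserted before it is known not to be a default value. -/
lemma integrable_response {c : Resp q}
    (hc : MemLp (oracleLoss (𝒳 := 𝒳) fun _ : Rep D => c) 2 P) :
    Integrable (fun z : Full D 𝒳 q => z.2.2) P := by
  have h := ((hc.integrable one_le_two).add (integrable_const (1 + ‖c‖)))
  have hm : Measurable fun z : Full D 𝒳 q => z.2.2 := by fun_prop
  refine h.mono' hm.aestronglyMeasurable (Eventually.of_forall fun z => ?_)
  have h1 : ‖z.2.2‖ ≤ ‖z.2.2 - c‖ + ‖c‖ := by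
    simpa using norm_add_le (z.2.2 - c) c
  simp only [Pi.add_apply, oracleLoss, sqLoss]
  nlinarith [sq_nonneg (‖z.2.2 - c‖ - 1)]

lemma IsSeededSample.tendsto_norm_sampleMean_sub (hZU : IsSeededSample μ P Z U)
    (hY : Integrable (fun z : Full D 𝒳 q => z.2.2) P)
    {S : (n : ℕ) → 𝒰 → Finset (Fin n)} {m : ℕ → ℕ} (hS : IsSeededSubset S m)
    (hm : Tendsto m atTop atTop) :
    Tendsto (fun p : ℕ × Ω => ‖((S p.1 (U p.2)).card : ℝ)⁻¹ •
      ∑ i ∈ S p.1 (U p.2), (Z i p.2).2.2 - ∫ z, z.2.2 ∂P‖ ^ 2) (whp μ) (𝓝 0) := by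
  have hcoord : ∀ j, Tendsto (fun p : ℕ × Ω => (((S p.1 (U p.2)).card : ℝ)⁻¹ •
      ∑ i ∈ S p.1 (U p.2), (Z i p.2).2.2 - ∫ z, z.2.2 ∂P) j) (whp μ) (𝓝 0) := by
    intro j
    have hYj : Integrable (fun z : Full D 𝒳 q => z.2.2 j) P :=
      (EuclideanSpace.proj (𝕜 := ℝ) j).integrable_comp hY
    have hint : (∫ z, z.2.2 ∂P) j = ∫ z, z.2.2 j ∂P :=
      ((EuclideanSpace.proj (𝕜 := ℝ) j).integral_comp_comm hY).symm
    have h := tendsto_sub_nhds_zero_iff.2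
      (hZU.tendsto_avg hS hm (f := fun z => z.2.2 j) (by fun_prop) hYj)
    refine h.congr fun p => ?_
    rw [PiLp.sub_apply, PiLp.smul_apply, hint, avg, div_eq_inv_mul, smul_eq_mul]
    simp
  have h := tendsto_finsetSum Finset.univ fun j _ => (hcoord j).pow 2
  simp only [EuclideanSpace.real_norm_sq_eq]
  simpa using h

end SampleMean

namespace Procedure

variable {D q K : ℕ} {𝒳 𝒰 Ω : Type*} [MeasurableSpace 𝒳] [MeasurableSpace 𝒰] [MeasurableSpace Ω]
  {𝒢 : Set (Rep D → Resp q)} {A : Procedure D q K 𝒳 𝒰 𝒢}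
  {μ : Measure Ω} {P : Measure (Full D 𝒳 q)} {Z : ℕ → Ω → Full D 𝒳 q} {U : Ω → 𝒰} {k : Fin K} {d : ℕ}

lemma tendsto_nuSqHat (hK : 2 ≤ K) {o₁ o₂ : Full D 𝒳 q → ℝ} {τ : ℝ}
    (h₁ : ∀ k, Tendsto (fun p : ℕ × Ω => A.sigmaSqHat p.1 (U p.2) (fun i => (Z i p.2).2) k d)
      (whp μ) (𝓝 (Var[o₁; P])))
    (h₂ : ∀ k, Tendsto (fun p : ℕ × Ω => A.sigmaSqHat p.1 (U p.2) (fun i => (Z i p.2).2) k D)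
      (whp μ) (𝓝 (Var[o₂; P]))) :
    Tendsto (fun p : ℕ × Ω => A.nuSqHat p.1 (U p.2) (fun i => (Z i p.2).2) τ d) (whp μ)
      (𝓝 ((1 - τ) * (Var[o₁; P] + Var[o₂; P]))) := by
  have hK0 : (K : ℝ) ≠ 0 := by positivity
  have h := ((tendsto_finsetSum Finset.univ fun k (_ : k ∈ Finset.univ) =>
    (h₁ k).add (h₂ k)).const_mul (1 / (K : ℝ))).const_mul (1 - τ)
  simp only [Finset.sum_const, Finset.card_univ, Fintype.card_fin, nsmul_eq_mul] at h
  rw [one_div, inv_mul_cancel_left₀ hK0, ← one_div] at h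
  exact h

variable [IsProbabilityMeasure μ] [IsProbabilityMeasure P]

/-- At order zero the consistency of the fitted loss is derived from the law of large numbers for
the training mean. -/
lemma approachesInL2_sampleMean (hZU : IsSeededSample μ P Z U)
    (hrule : ∀ n u x, A.rule n u k 0 x =
      fun _ => ((A.train n u k).card : ℝ)⁻¹ • ∑ i ∈ A.train n u k, (x i).2)
    (hL : MemLp (oracleLoss (𝒳 := 𝒳) fun _ : Rep D => ∫ z, z.2.2 ∂P) 2 P)
    (hm : Tendsto (fun n => n - (2 * A.sizeA n k + A.sizeO n k)) atTop atTop) :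
    ApproachesInL2 μ P Z U (A.fitLoss k 0) (oracleLoss fun _ => ∫ z, z.2.2 ∂P) := by
  have hs := hZU.tendsto_norm_sampleMean_sub (integrable_response hL) (A.isSeededSubset_train k) hm
  have hb := ((hs.pow 2).const_mul 2).add
    ((hs.const_mul 8).mul_const (∫ z, oracleLoss (𝒳 := 𝒳) (fun _ : Rep D => ∫ z, z.2.2 ∂P) z ∂P))
  have hb' := (ENNReal.continuous_ofReal.tendsto _).comp hb
  norm_num at hb'
  refine tendsto_of_tendsto_of_tendsto_of_le_of_le tendsto_const_nhds hb' (fun _ => zero_le)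
    fun p => ?_
  have hi := hL.integrable one_le_two
  simp only [Function.comp_apply]
  generalize hV : ((A.train p.1 (U p.2) k).card : ℝ)⁻¹ •
    ∑ i ∈ A.train p.1 (U p.2) k, (Z i p.2).2.2 = V
  have hfit : ∀ z, A.fitLoss k 0 p.1 (U p.2) (fun i => Z i p.2) z = sqLoss z.2.2 V := by
    intro z
    simp only [fitLoss, plugInLoss, fitRule, hrule]
    rw [hV]
  generalize (∫ z, z.2.2 ∂P) = c at *
  simp only [hfit]
  have hii := (integrable_const (μ := P) (2 * (‖V - c‖ ^ 2) ^ 2)).add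
    (hi.const_mul (8 * ‖V - c‖ ^ 2))
  calc _ ≤ ∫⁻ z, ENNReal.ofReal (2 * (‖V - c‖ ^ 2) ^ 2 +
        8 * ‖V - c‖ ^ 2 * oracleLoss (fun _ => c) z) ∂P :=
        lintegral_mono fun z => ENNReal.ofReal_le_ofReal (sq_sqLoss_sub_le _ _ _)
    _ = ENNReal.ofReal (∫ z, (2 * (‖V - c‖ ^ 2) ^ 2 +
        8 * ‖V - c‖ ^ 2 * oracleLoss (𝒳 := 𝒳) (fun _ : Rep D => c) z) ∂P) := by
        refine (ofReal_integral_eq_lintegral_ofReal hii (Eventually.of_forall fun z => ?_)).symm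
        have := oracleLoss_nonneg (fun _ => c) z
        simp only [Pi.add_apply, Pi.zero_apply]
        positivity
    _ ≤ _ := by
        rw [integral_add (integrable_const _) (hi.const_mul _), integral_const,
          integral_const_mul]
        simp

/-! ### The test statistics -/

/-- The contrasts are consistent at every rate `r` at which the means of the fitted losses are. -/
lemma tendsto_psiHat_rate (hK : 2 ≤ K) (hd : d ≤ D) {τ : ℝ} (hτ0 : 0 ≤ τ) (hτ1 : τ < 1)
    (hfold : ∀ k, Tendsto (fun n : ℕ => (2 * A.sizeA n k + A.sizeO n k : ℝ) / n) atTop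
      (𝓝 (1 / (K : ℝ))))
    (hoverlap : ∀ k, Tendsto
      (fun n : ℕ => (A.sizeO n k : ℝ) / (A.sizeA n k + A.sizeO n k)) atTop (𝓝 τ))
    (hZU : IsSeededSample μ P Z U) {o₁ o₂ : Full D 𝒳 q → ℝ}
    (ho₁ : Measurable o₁) (ho₂ : Measurable o₂) (hL₁ : MemLp o₁ 2 P) (hL₂ : MemLp o₂ 2 P)
    (h₁ : ∀ k, ApproachesInL2 μ P Z U (A.fitLoss k d) o₁)
    (h₂ : ∀ k, ApproachesInL2 μ P Z U (A.fitLoss k D) o₂) {r : ℕ → ℝ}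
    (hr : Tendsto (fun n : ℕ => (n : ℝ) * r n ^ 2) atTop atTop)
    (hm₁ : ∀ k, Tendsto (fun p => (fitMean P Z U (A.fitLoss k d) p - ∫ z, o₁ z ∂P) / r p.1)
      (whp μ) (𝓝 0))
    (hm₂ : ∀ k, Tendsto (fun p => (fitMean P Z U (A.fitLoss k D) p - ∫ z, o₂ z ∂P) / r p.1)
      (whp μ) (𝓝 0)) :
    Tendsto (fun p : ℕ × Ω => (A.psiHat p.1 (U p.2) (fun i => (Z i p.2).2) τ d -
      (∫ z, o₁ z ∂P - ∫ z, o₂ z ∂P)) / r p.1) (whp μ) (𝓝 0) := by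
  have hK0 : (0 : ℝ) < K := by positivity
  have hsize : ∀ {s : ℕ → ℕ} {c : ℝ}, 0 < c → Tendsto (fun n : ℕ => (s n : ℝ) / n) atTop (𝓝 c) →
      Tendsto (fun n => (s n : ℝ) * r n ^ 2) atTop atTop := by
    intro s c hc hs
    refine (hs.pos_mul_atTop hc hr).congr' ?_
    filter_upwards [eventually_gt_atTop 0] with n hn
    have : (n : ℝ) ≠ 0 := by exact_mod_cast hn.ne'
    field_simp
  have hcA : 0 < (1 - τ) / (2 - τ) * (1 / K) := by
    have : 0 < 1 - τ := by linarith
    have : 0 < 2 - τ := by linarith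
    positivity
  have hsA := fun k => hsize hcA (tendsto_size_div (hfold k) (hoverlap k) hK hτ1).1
  have ha₁ := fun k => (h₁ k).tendsto_avg_rate
    (A.isFittedOutside_fitLoss k hd fun n u => A.part_subset_fold n u k 0) ho₁ hL₁ hZU
    (A.isSeededSubset_part_zero k) (hsA k) (hm₁ k)
  have hb₂ := fun k => (h₂ k).tendsto_avg_rate
    (A.isFittedOutside_fitLoss k le_rfl fun n u => A.part_subset_fold n u k 1) ho₂ hL₂ hZU
    (A.isSeededSubset_part_one k) (hsA k) (hm₂ k)
  have hover : ∀ {e : ℕ} {o : Full D 𝒳 q → ℝ} (k : Fin K), e ≤ D → Measurable o → MemLp o 2 P →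
      ApproachesInL2 μ P Z U (A.fitLoss k e) o →
      Tendsto (fun p => (fitMean P Z U (A.fitLoss k e) p - ∫ z, o z ∂P) / r p.1) (whp μ) (𝓝 0) →
      Tendsto (fun p : ℕ × Ω => τ * ((avg (A.part p.1 (U p.2) k 2)
        (fun i => A.fitLoss k e p.1 (U p.2) (fun i => Z i p.2) (Z i p.2)) - ∫ z, o z ∂P) /
          r p.1)) (whp μ) (𝓝 0) := by
    intro e o k he ho hoL h hm
    -- For `τ = 0` the overlap parts may stay small or empty, but their weight vanishes.
    rcases hτ0.eq_or_lt with rfl | hτ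
    · simp only [zero_mul]
      exact tendsto_const_nhds
    · have hcO : 0 < τ / (2 - τ) * (1 / K) := by
        have : 0 < 2 - τ := by linarith
        positivity
      simpa using (h.tendsto_avg_rate
        (A.isFittedOutside_fitLoss k he fun n u => A.part_subset_fold n u k 2) ho hoL hZU
        (A.isSeededSubset_part_two k)
        (hsize hcO (tendsto_size_div (hfold k) (hoverlap k) hK hτ1).2) hm).const_mul τ
  have h := (tendsto_finsetSum Finset.univ fun k (_ : k ∈ Finset.univ) =>
    ((hover k hd ho₁ hL₁ (h₁ k) (hm₁ k)).add ((ha₁ k).const_mul (1 - τ))).sub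
      ((hover k le_rfl ho₂ hL₂ (h₂ k) (hm₂ k)).add ((hb₂ k).const_mul (1 - τ)))).const_mul
        (1 / (K : ℝ))
  simp only [mul_zero, add_zero, sub_zero, Finset.sum_const_zero] at h
  refine h.congr fun p => ?_
  have hconst : ∀ c : ℝ, c = 1 / (K : ℝ) * ∑ _k : Fin K, c := by
    intro c
    simp only [Finset.sum_const, Finset.card_univ, Fintype.card_fin, nsmul_eq_mul]
    field_simp
  rw [hconst (∫ z, o₁ z ∂P - ∫ z, o₂ z ∂P), psiHat, ← mul_sub, ← Finset.sum_sub_distrib,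
    mul_div_assoc, Finset.sum_div]
  congr 1
  refine Finset.sum_congr rfl fun k _ => ?_
  rw [loss_eq_fitLoss A p.1 (U p.2) (fun i => Z i p.2),
    loss_eq_fitLoss A p.1 (U p.2) (fun i => Z i p.2)]
  ring

/-- Statistics beyond `t` play no role, and the inserted fallback `D` is at least `t`. -/
lemma dHat_eq {n : ℕ} {u : 𝒰} {x : Fin n → Obs 𝒳 q} {τ α : ℝ} {t : ℕ} (ht : t ≤ D)
    (hlt : ∀ d < t, normalQuantile (1 - α) < A.tStat n u x τ d)
    (hT : A.tStat n u x τ t < normalQuantile (1 - α)) : A.dHat n u x τ α = t := by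
  unfold dHat
  refine le_antisymm (Nat.sInf_le (Set.mem_insert_of_mem _ ⟨ht, hT⟩))
    (le_csInf ⟨D, Set.mem_insert _ _⟩ ?_)
  rintro d (rfl | ⟨-, hd⟩)
  · exact ht
  · by_contra! h
    exact lt_asymm hd (hlt d h)

end Procedure

namespace Procedure

variable {D q K : ℕ} {𝒳 𝒰 Ω : Type*} [MeasurableSpace 𝒳] [MeasurableSpace 𝒰] [MeasurableSpace Ω]
  {𝒢 : Set (Rep D → Resp q)} {A : Procedure D q K 𝒳 𝒰 𝒢}
  {μ : Measure Ω} {P : Measure (Full D 𝒳 q)} [IsProbabilityMeasure P]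
  {Z : ℕ → Ω → Full D 𝒳 q} {U : Ω → 𝒰} {k : Fin K} {d : ℕ}

/-- Curvature turns accuracy `o_P(n^{-1/4})` in the norm into accuracy `O_P(n^{-1/2})` of the mean
of the fitted losses. -/
lemma eventually_abs_fitMean_sub_le {N : (Full D 𝒳 q → Resp q) → ℝ≥0∞} {g₀ : Rep D → Resp q}
    (hd : d ≤ D) (hg : Measurable g₀) (hL : MemLp (oracleLoss (𝒳 := 𝒳) g₀) 2 P)
    (hC1 : RiskCurvature P 𝒢 N g₀ d)
    (hC2 : IsLittleOP μ (fun n ω => N (ruleGap (A.fitReduce n (U ω) k fun i => Z i ω)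
      (A.fitRule n (U ω) k d fun i => Z i ω) g₀)) fun n => (n : ℝ) ^ (-(1 / 4) : ℝ))
    (h : ApproachesInL2 μ P Z U (A.fitLoss k d) (oracleLoss g₀)) :
    ∃ C > 0, ∀ᶠ p in whp μ,
      |fitMean P Z U (A.fitLoss k d) p - ∫ z, oracleLoss g₀ z ∂P| ≤ C / √(p.1 : ℝ) := by
  obtain ⟨C, hC, δ, hδ, hcurv⟩ := hC1.exists_forall
  refine ⟨C, hC, ?_⟩
  -- The bound `δ` brings the fit into the curvature neighbourhood, as `n^{-1/4} ≤ 1`; the bound `1`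
  -- keeps the final constant equal to `C`.
  have hε : 0 < min 1 δ := lt_min one_pos hδ
  have hH := A.isFittedOutside_fitLoss k hd fun _ _ => subset_rfl
  filter_upwards [hC2.eventually hε, h.eventually_fitMean hH (measurable_oracleLoss hg) hL one_pos,
    tendsto_fst_whp.eventually (eventually_ge_atTop 1)] with p hp hf hn
  have hn1 : (1 : ℝ) ≤ p.1 := by exact_mod_cast hn
  have hpow0 : 0 ≤ (p.1 : ℝ) ^ (-(1 / 4) : ℝ) := by positivity
  have hpow1 : (p.1 : ℝ) ^ (-(1 / 4) : ℝ) ≤ 1 := Real.rpow_le_one_of_one_le_of_nonpos hn1 (by norm_num)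
  have hpow2 : ((p.1 : ℝ) ^ (-(1 / 4) : ℝ)) ^ 2 = 1 / √(p.1 : ℝ) := by
    rw [← Real.rpow_natCast, ← Real.rpow_mul (by linarith), Real.sqrt_eq_rpow,
      one_div ((p.1 : ℝ) ^ (1 / 2 : ℝ)), ← Real.rpow_neg (by linarith)]
    norm_num
  have hNδ := hp.trans (ENNReal.ofReal_le_ofReal
    (show min 1 δ * (p.1 : ℝ) ^ (-(1 / 4) : ℝ) ≤ δ by
      nlinarith [min_le_right 1 δ, mul_le_of_le_one_right hε.le hpow1]))
  have hN1 := hp.trans (ENNReal.ofReal_le_ofReal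
    (mul_le_of_le_one_left hpow0 (min_le_left 1 δ)))
  have hb := hcurv _ _ (A.measurable_fitReduce _ _ _ _) (A.rule_mem _ _ _ _ _ hd) hNδ
  rw [← ENNReal.ofReal_le_ofReal_iff (by positivity), fitMean,
    ← integral_sub (hf.1.integrable one_le_two) (hL.integrable one_le_two)]
  calc _ ≤ _ := hb
    _ ≤ ENNReal.ofReal C * ENNReal.ofReal ((p.1 : ℝ) ^ (-(1 / 4) : ℝ)) ^ 2 := by
      gcongr
      exact hN1
    _ = ENNReal.ofReal (C / √(p.1 : ℝ)) := by
      rw [← ENNReal.ofReal_pow hpow0, ← ENNReal.ofReal_mul hC.le, hpow2, mul_one_div]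

end Procedure

end POD

end

/-! ### Rejection below the target order and acceptance at it -/

open POD POD.Procedure in
theorem theorem3
    {D q K : ℕ} {𝒳 𝒰 Ω : Type*} [MeasurableSpace 𝒳] [MeasurableSpace 𝒰] [MeasurableSpace Ω]
    -- the law of `Z = (R, X, Y)`, the class of rules, and the oracle rules `g_d`
    (P : Measure (POD.Full D 𝒳 q)) [IsProbabilityMeasure P]
    (𝒢 : Set (POD.Rep D → POD.Resp q)) (h𝒢 : ∀ g ∈ 𝒢, Measurable g)
    (g : ℕ → POD.Rep D → POD.Resp q)
    (hg : ∀ d ≤ D, POD.IsRiskMinimizer P 𝒢 d (g d))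
    -- the variances of the oracle losses are finite, and positive at `d*`
    (hvar : ∀ d ≤ POD.targetOrder P 𝒢, MemLp (POD.oracleLoss (𝒳 := 𝒳) (g d)) 2 P)
    (hpos : 0 < variance (POD.oracleLoss (𝒳 := 𝒳) (g (POD.targetOrder P 𝒢))) P)
    -- i.i.d. draws from `P` and an independent seed
    (μ : Measure Ω) [IsProbabilityMeasure μ]
    (Z : ℕ → Ω → POD.Full D 𝒳 q) (hZ : ∀ i, Measurable (Z i))
    (hlaw : ∀ i, μ.map (Z i) = P) (hindep : iIndepFun Z μ)
    (U : Ω → 𝒰) (hU : Measurable U) (hseed : IndepFun U (fun ω i => Z i ω) μ)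
    -- the procedure: `K ≥ 2` asymptotically balanced folds, overlap proportion `τ`
    (A : POD.Procedure D q K 𝒳 𝒰 𝒢) (hK : 2 ≤ K)
    (τ : ℝ) (hτ0 : 0 ≤ τ) (hτ1 : τ < 1)
    (hfold : ∀ k, Tendsto (fun n : ℕ => (2 * A.sizeA n k + A.sizeO n k : ℝ) / n) atTop
      (𝓝 (1 / (K : ℝ))))
    (hoverlap : ∀ k, Tendsto
      (fun n : ℕ => (A.sizeO n k : ℝ) / (A.sizeA n k + A.sizeO n k)) atTop (𝓝 τ))
    -- risk curvature, learning accuracy and consistency at orders `d ≥ d*`, in a generic norm `N`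
    (N : (POD.Full D 𝒳 q → POD.Resp q) → ℝ≥0∞) (hN : POD.IsGenericNorm N)
    (hC1 : ∀ d, POD.targetOrder P 𝒢 ≤ d → d ≤ D →
      POD.RiskCurvature P 𝒢 N (g (POD.targetOrder P 𝒢)) d)
    (hC2 : ∀ k d, POD.targetOrder P 𝒢 ≤ d → d ≤ D →
      POD.IsLittleOP μ
        (fun n ω => N (POD.ruleGap (A.reduce n (U ω) k fun i => (Z i ω).2)
          (A.rule n (U ω) k d fun i => (Z i ω).2) (g (POD.targetOrder P 𝒢))))
        (fun n => (n : ℝ) ^ (-(1 / 4) : ℝ)))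
    (hC3 : ∀ k d, POD.targetOrder P 𝒢 ≤ d → d ≤ D →
      POD.IsLittleOP μ
        (fun n ω => POD.sqLossGap P (A.reduce n (U ω) k fun i => (Z i ω).2)
          (A.rule n (U ω) k d fun i => (Z i ω).2) (g (POD.targetOrder P 𝒢)))
        (fun _ => 1))
    -- learning accuracy and consistency at orders `1 ≤ d < d*`
    (hC2' : ∀ k d, 1 ≤ d → d < POD.targetOrder P 𝒢 →
      POD.IsLittleOP μ
        (fun n ω => eLpNorm (POD.ruleGap (A.reduce n (U ω) k fun i => (Z i ω).2)
          (A.rule n (U ω) k d fun i => (Z i ω).2) (g d)) 2 P)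
        (fun n => (n : ℝ) ^ (-(1 / 4) : ℝ)))
    (hC3' : ∀ k d, 1 ≤ d → d < POD.targetOrder P 𝒢 →
      POD.IsLittleOP μ
        (fun n ω => POD.sqLossGap P (A.reduce n (U ω) k fun i => (Z i ω).2)
          (A.rule n (U ω) k d fun i => (Z i ω).2) (g d))
        (fun _ => 1))
    -- the order `0`, if it lies below the target order: `g_0 = E(Y)`, fitted by the sample mean
    (hzero : 0 < POD.targetOrder P 𝒢 →
      (g 0 = fun _ => ∫ z, z.2.2 ∂P) ∧
      ∀ n u k x, A.rule n u k 0 x =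
        fun _ => ((A.train n u k).card : ℝ)⁻¹ • ∑ i ∈ A.train n u k, (x i).2)
    -- the levels
    (α : ℕ → ℝ) (hα : ∀ n, 0 < α n ∧ α n < 1)
    (hα0 : Tendsto α atTop (𝓝 0))
    (hαlog : Tendsto (fun n : ℕ => Real.log (α n) / n) atTop (𝓝 0)) :
    Tendsto
      (fun n => μ {ω | A.dHat n (U ω) (fun i => (Z i ω).2) τ (α n) = POD.targetOrder P 𝒢})
      atTop (𝓝 1) := by
  set t := targetOrder P 𝒢 with ht
  have htD : t ≤ D := targetOrder_spec.1
  have hZU : IsSeededSample μ P Z U := isSeededSample_of_iIndepFun hZ hlaw hindep hU hseed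
  have hgm : ∀ d ≤ D, Measurable (g d) := fun d hd => h𝒢 _ (hg d hd).1.1
  have hom : ∀ d ≤ t, Measurable (oracleLoss (𝒳 := 𝒳) (g d)) := fun d hd =>
    measurable_oracleLoss (hgm d (hd.trans htD))
  -- The index `min d t` records that fits at all orders from `t` on share the limit `g t`.
  have hA : ∀ k d, d ≤ D →
      ApproachesInL2 μ P Z U (A.fitLoss k d) (oracleLoss (g (min d t))) := by
    intro k d hd
    rcases le_or_gt t d with htd | hdt
    · rw [min_eq_right htd]
      exact (hC3 k d htd hd).tendsto
    · rw [min_eq_left hdt.le]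
      rcases Nat.eq_zero_or_pos d with rfl | hd0
      · obtain ⟨hg0, hrule⟩ := hzero hdt
        rw [hg0]
        exact approachesInL2_sampleMean hZU (fun n u x => hrule n u k x) (hg0 ▸ hvar 0 (Nat.zero_le _))
          (tendsto_size_train (hfold k) hK)
      · exact (hC3' k d hd0 hdt).tendsto
  have hAD : ∀ k, ApproachesInL2 μ P Z U (A.fitLoss k D) (oracleLoss (g t)) := fun k => by
    simpa [min_eq_right htD] using hA k D le_rfl
  have hH := fun k d (hd : d ≤ D) => A.isFittedOutside_fitLoss k hd fun _ _ => subset_rfl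
  have hsig : ∀ k d, d ≤ D → Tendsto
      (fun p : ℕ × Ω => A.sigmaSqHat p.1 (U p.2) (fun i => (Z i p.2).2) k d) (whp μ)
      (𝓝 (Var[oracleLoss (𝒳 := 𝒳) (g (min d t)); P])) := by
    intro k d hd
    have h := (hA k d hd).tendsto_sampleVariance (hH k d hd) (hom _ (min_le_right _ _))
      (hvar _ (min_le_right _ _)) hZU (A.isSeededSubset_fold k) (tendsto_size_fold (hfold k) hK)
    exact h
  have hnu : ∀ d ≤ t, ∃ ν > 0, Tendsto
      (fun p : ℕ × Ω => √(A.nuSqHat p.1 (U p.2) (fun i => (Z i p.2).2) τ d)) (whp μ) (𝓝 ν) := by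
    intro d hd
    have h1 := tendsto_nuSqHat (τ := τ) hK (fun k => hsig k d (hd.trans htD))
      fun k => hsig k D le_rfl
    refine ⟨_, Real.sqrt_pos.2 ?_, h1.sqrt⟩
    rw [min_eq_right htD]
    have := variance_nonneg (oracleLoss (𝒳 := 𝒳) (g (min d t))) P
    have : 0 < 1 - τ := by linarith
    positivity
  -- The variance at order `D` has the limit at `t`, which is positive, so the denominators are
  -- nondegenerate even where the loss at `d` is constant.
  set z : ℕ → ℝ := fun n => normalQuantile (1 - α n) with hz
  have hz1 : Tendsto z atTop atTop := tendsto_normalQuantile (fun n => (hα n).1) hα0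
  have hz2 : Tendsto (fun n : ℕ => z n / √(n : ℝ)) atTop (𝓝 0) :=
    tendsto_normalQuantile_div_sqrt hα hα0 hαlog
  have h2τ : 0 < √(2 - τ) := Real.sqrt_pos.2 (by linarith)
  have hrej : ∀ d < t, ∀ᶠ p in whp μ,
      z p.1 < A.tStat p.1 (U p.2) (fun i => (Z i p.2).2) τ d := by
    intro d hd
    have hdD := hd.le.trans htD
    have hmin : min d t = d := min_eq_left hd.le
    have hAd := fun k => hmin ▸ hA k d hdD
    have hmean : ∀ k, Tendsto (fun p => (fitMean P Z U (A.fitLoss k d) p -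
        ∫ z, oracleLoss (g d) z ∂P) / 1) (whp μ) (𝓝 0) := fun k => by
      simpa using tendsto_sub_nhds_zero_iff.2
        ((hAd k).tendsto_fitMean (hH k d hdD) (hom d hd.le) (hvar d hd.le))
    have hmeanD : ∀ k, Tendsto (fun p => (fitMean P Z U (A.fitLoss k D) p -
        ∫ z, oracleLoss (g t) z ∂P) / 1) (whp μ) (𝓝 0) := fun k => by
      simpa using tendsto_sub_nhds_zero_iff.2
        ((hAD k).tendsto_fitMean (hH k D le_rfl) (hom t le_rfl) (hvar t le_rfl))
    have hpsi := tendsto_psiHat_rate (r := fun _ => 1) hK hdD hτ0 hτ1 hfold hoverlap hZU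
      (hom d hd.le) (hom t le_rfl) (hvar d hd.le) (hvar t le_rfl) hAd hAD
      (by simpa using tendsto_natCast_atTop_atTop (R := ℝ)) hmean hmeanD
    simp only [div_one] at hpsi
    rw [tendsto_sub_nhds_zero_iff] at hpsi
    obtain ⟨ν, hν, hnud⟩ := hnu d hd.le
    have hlt : ∫ z, oracleLoss (𝒳 := 𝒳) (g t) z ∂P < ∫ z, oracleLoss (𝒳 := 𝒳) (g d) z ∂P := by
      refine integral_oracleLoss_lt ((hvar t le_rfl).integrable one_le_two)
        ((hvar d hd.le).integrable one_le_two) ?_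
      rw [(hg t htD).2, (hg d hdD).2]
      exact predictiveness_lt hd
    -- The limit of `(T̂_d - z_n) / √n`, whose positivity is the rejection.
    have hlim := ((hpsi.div hnud hν.ne').div_const √(2 - τ)).sub (hz2.comp tendsto_fst_whp)
    have hlim0 : 0 < (∫ z, oracleLoss (𝒳 := 𝒳) (g d) z ∂P - ∫ z, oracleLoss (𝒳 := 𝒳) (g t) z ∂P) /
        ν / √(2 - τ) - 0 := by
      have := sub_pos.2 hlt
      rw [sub_zero]
      positivity
    filter_upwards [hlim.eventually (eventually_gt_nhds hlim0),
      tendsto_fst_whp.eventually (eventually_gt_atTop 0)] with p hp hn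
    have hn0 : (0 : ℝ) < √(p.1 : ℝ) := Real.sqrt_pos.2 (by exact_mod_cast hn)
    simp only [Function.comp_apply, Pi.div_apply, sub_pos] at hp
    rw [div_lt_iff₀ hn0] at hp
    refine hp.trans_eq ?_
    rw [tStat, Real.sqrt_div (Nat.cast_nonneg _)]
    ring
  have hacc : ∀ᶠ p in whp μ, A.tStat p.1 (U p.2) (fun i => (Z i p.2).2) τ t < z p.1 := by
    have hrate : ∀ k d, t ≤ d → d ≤ D → Tendsto (fun p => (fitMean P Z U (A.fitLoss k d) p -
        ∫ z, oracleLoss (g t) z ∂P) / (z p.1 / √(p.1 : ℝ))) (whp μ) (𝓝 0) := by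
      intro k d htd hd
      obtain ⟨C, hC, hb⟩ := eventually_abs_fitMean_sub_le hd (hgm t htD) (hvar t le_rfl)
        (hC1 d htd hd) (hC2 k d htd hd) (hC3 k d htd hd).tendsto
      refine squeeze_zero_norm' ?_ ((hz1.const_div_atTop C).comp tendsto_fst_whp)
      filter_upwards [hb, tendsto_fst_whp.eventually (eventually_gt_atTop 0),
        tendsto_fst_whp.eventually (hz1.eventually_gt_atTop 0)] with p hp hn hzp
      have hn0 : (0 : ℝ) < √(p.1 : ℝ) := Real.sqrt_pos.2 (by exact_mod_cast hn)
      rw [norm_div, Real.norm_eq_abs, Real.norm_of_nonneg (by positivity)]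
      calc _ ≤ C / √(p.1 : ℝ) / (z p.1 / √(p.1 : ℝ)) := by gcongr
        _ = _ := by
          simp only [Function.comp_apply]
          field_simp
    -- For this rate `n r_n² = z_n²`, so the noise is negligible exactly because the critical values
    -- diverge.
    have hr : Tendsto (fun n : ℕ => (n : ℝ) * (z n / √(n : ℝ)) ^ 2) atTop atTop := by
      refine ((tendsto_pow_atTop two_ne_zero).comp hz1).congr' ?_
      filter_upwards [eventually_gt_atTop 0] with n hn
      have hn0 : (n : ℝ) ≠ 0 := by exact_mod_cast hn.ne'
      simp only [Function.comp_apply]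
      rw [div_pow, Real.sq_sqrt (Nat.cast_nonneg _)]
      field_simp
    have hpsi := tendsto_psiHat_rate hK htD hτ0 hτ1 hfold hoverlap hZU
      (hom t le_rfl) (hom t le_rfl) (hvar t le_rfl) (hvar t le_rfl)
      (fun k => (hC3 k t le_rfl htD).tendsto) hAD hr (fun k => hrate k t le_rfl htD)
      fun k => hrate k D htD le_rfl
    simp only [sub_self, sub_zero] at hpsi
    obtain ⟨ν, hν, hnut⟩ := hnu t le_rfl
    have hlim := (hpsi.div hnut hν.ne').div_const √(2 - τ)
    rw [zero_div, zero_div] at hlim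
    filter_upwards [hlim.eventually (eventually_lt_nhds one_pos),
      tendsto_fst_whp.eventually (eventually_gt_atTop 0),
      tendsto_fst_whp.eventually (hz1.eventually_gt_atTop 0)] with p hp hn hzp
    have hn0 : (0 : ℝ) < √(p.1 : ℝ) := Real.sqrt_pos.2 (by exact_mod_cast hn)
    -- The statistic is `z_n` times a factor that tends to zero in probability, and that factor is
    -- eventually below one.
    refine lt_of_eq_of_lt ?_ (mul_lt_of_lt_one_right hzp hp)
    simp only [Pi.div_apply]
    rw [tStat, Real.sqrt_div (Nat.cast_nonneg _)]
    field_simp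
  have hall : ∀ᶠ p in whp μ, ∀ d ∈ Finset.range t,
      z p.1 < A.tStat p.1 (U p.2) (fun i => (Z i p.2).2) τ d :=
    (Filter.eventually_all_finset _).2 fun d hd => hrej d (Finset.mem_range.1 hd)
  have hfin := hall.and hacc
  refine tendsto_measure_one_of_whp
    (p := fun p : ℕ × Ω => A.dHat p.1 (U p.2) (fun i => (Z i p.2).2) τ (α p.1) = t) ?_
  filter_upwards [hfin] with p hp
  exact dHat_eq htD (fun d hd => hp.1 d (Finset.mem_range.2 hd)) hp.2
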